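/- Let $M$ be a smooth ($C^\infty$) $n$-dimensional manifold and let $(h,W)$ be navigation data on $M$, i.e. $h$ is a smooth Riemannian metric and $W$ is a smooth vector field with $\|W\|^2=h(W,W)<1$ everywhere. Let $\nabla^R$ be the Levi-Civita connection of $h$, with Christoffel symbols $A^k_{ij}$ in local coordinates $(x^i)$ on $M$, and let $$\mathcal F(x,y)=\frac{\sqrt{h(y,W)^2+\lambda\,h(y,y)}}{\lambda}-\frac{h(y,W)}{\lambda},\qquad \lambda=1-\|W\|^2,$$ be the Randers metric associated with $(h,W)$. In the induced coordinates $(x^i,y^i)$ on $TM$, consider on $TM\setminus\{0\}$: - the natural spray $S=y^k\frac{\partial}{\partial x^k}-2G^k\frac{\partial}{\partial y^k}$ of $(h,W)$, with coefficients $$G^k(x,y)=\tfrac12\Bigl(A^k_{ij}y^iy^j-\mathcal F(x,y)\,y^iA^k_{ij}W^j-\mathcal F(x,y)\,y^i\tfrac{\partial W^k}{\partial x^i}\Bigr);$$ - the geodesic spray $\tilde S=y^k\frac{\partial}{\partial x^k}-2\tilde G^k\frac{\partial}{\partial y^k}$ of $\mathcal F$, with coefficients $$\tilde G^k=\tfrac12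 g^{kl}\Bigl(\frac{\partial^2E}{\partial x^i\partial y^l}y^i-\frac{\partial E}{\partial x^l}\Bigr),\qquad E=\tfrac12\mathcal F^2,\quad g_{ij}=\frac{\partial^2E}{\partial y^i\partial y^j},\quad (g^{kl})=(g_{ij})^{-1}.$$ Then $S=\tilde S$ on $TM\setminus\{0\}$ if and only if $W$ is a concircular vector field with respect to $h$, i.e. there is a function $\varphi\in C^\infty(M)$ such that $\nabla^R_XW=\varphi X$ for all tangent vectors $X$ (equivalently, all vector fields $X$). -/

import Mathlib

open scoped Manifold ContDiff

noncomputable section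

namespace Navigation

/-- Navigation data `(h, W)` on `M`: a smooth Riemannian metric `h` and a smooth vector field `W`
with `‖W‖² = h(W, W) < 1` everywhere. -/
structure NavigationData (n : ℕ) (M : Type*) [TopologicalSpace M]
    [ChartedSpace (EuclideanSpace ℝ (Fin n)) M] [IsManifold (𝓡 n) ∞ M] where
  /-- the Riemannian metric `h` -/
  metric : Bundle.ContMDiffRiemannianMetric (𝓡 n) ∞ (EuclideanSpace ℝ (Fin n))
    (fun x : M => TangentSpace (𝓡 n) x)
  /-- the wind `W` -/
  wind : ∀ x : M, TangentSpace (𝓡 n) x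
  contMDiff_wind : ContMDiff (𝓡 n) (𝓡 n).tangent ∞
    (fun x => (⟨x, wind x⟩ : TangentBundle (𝓡 n) M))
  norm_wind_lt_one : ∀ x, metric.inner x (wind x) (wind x) < 1

/-- The partial derivative `∂f/∂xⁱ` at the point `u` of `ℝⁿ`. -/
def partialDeriv {n : ℕ} (i : Fin n) (f : EuclideanSpace ℝ (Fin n) → ℝ)
    (u : EuclideanSpace ℝ (Fin n)) : ℝ :=
  fderiv ℝ f u (EuclideanSpace.single i 1)

variable {n : ℕ} {M : Type*} [TopologicalSpace M] [ChartedSpace (EuclideanSpace ℝ (Fin n)) M]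
  [IsManifold (𝓡 n) ∞ M]

/-- The inverse of the chart of `TM` induced by the chart `e` of `M`: the pair `(u, y)` of
coordinates `(xⁱ, yⁱ)` is sent to the tangent vector `yⁱ ∂/∂xⁱ` at the point `e⁻¹(u)`. -/
def tangentParam (e : OpenPartialHomeomorph M (EuclideanSpace ℝ (Fin n)))
    (z : EuclideanSpace ℝ (Fin n) × EuclideanSpace ℝ (Fin n)) : TangentBundle (𝓡 n) M :=
  ⟨e.symm z.1, mfderiv (𝓡 n) (𝓡 n) e.symm z.1 z.2⟩

/-- The components `(Xⁱ)` in the chart `e` of a tangent vector `X` at the point `p`. -/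
def components (e : OpenPartialHomeomorph M (EuclideanSpace ℝ (Fin n))) (p : M)
    (X : TangentSpace (𝓡 n) p) : EuclideanSpace ℝ (Fin n) :=
  mfderiv (𝓡 n) (𝓡 n) e p X

/-- The value at `v ∈ TM` (over the domain of the chart `e`) of the vector field
`yᵏ ∂/∂xᵏ - 2 Gᵏ(x, y) ∂/∂yᵏ` on `TM`, where `(xⁱ, yⁱ)` are the coordinates on `TM` induced
by the chart `e`. -/
def sprayOfCoeff (e : OpenPartialHomeomorph M (EuclideanSpace ℝ (Fin n)))
    (G : EuclideanSpace ℝ (Fin n) → EuclideanSpace ℝ (Fin n) → Fin n → ℝ)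
    (v : TangentBundle (𝓡 n) M) : TangentSpace (𝓡 n).tangent v :=
  let u : EuclideanSpace ℝ (Fin n) := e v.proj
  let y : EuclideanSpace ℝ (Fin n) := components e v.proj v.2
  mfderiv 𝓘(ℝ, EuclideanSpace ℝ (Fin n) × EuclideanSpace ℝ (Fin n)) (𝓡 n).tangent
    (tangentParam e) (u, y) (y, WithLp.toLp 2 (fun k => -2 * G u y k))

/-! ### The geodesic spray of a Finsler function -/

/-- The energy `E = F² / 2` in the coordinates induced by the chart `e`. -/
def energy (F : TangentBundle (𝓡 n) M → ℝ)
    (e : OpenPartialHomeomorph M (EuclideanSpace ℝ (Fin n)))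
    (u y : EuclideanSpace ℝ (Fin n)) : ℝ :=
  F (tangentParam e (u, y)) ^ 2 / 2

/-- The matrix `g_{ij} = ∂²E / ∂yⁱ∂yʲ` of the metric tensor of the Finsler function `F`. -/
def fundamentalTensor (F : TangentBundle (𝓡 n) M → ℝ)
    (e : OpenPartialHomeomorph M (EuclideanSpace ℝ (Fin n)))
    (u y : EuclideanSpace ℝ (Fin n)) : Matrix (Fin n) (Fin n) ℝ :=
  Matrix.of fun i j =>
    partialDeriv i (fun y' => partialDeriv j (fun y'' => energy F e u y'') y') y

/-- The coefficients of the geodesic spray of the Finsler function `F`,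
`Gᵏ = ½ gᵏˡ (∂²E/∂xⁱ∂yˡ yⁱ - ∂E/∂xˡ)`: the equations `ẍᵏ + 2 Gᵏ(x, ẋ) = 0` are the
Euler-Lagrange equations of `E = F² / 2`. -/
def geodesicSprayCoeff (F : TangentBundle (𝓡 n) M → ℝ)
    (e : OpenPartialHomeomorph M (EuclideanSpace ℝ (Fin n)))
    (u y : EuclideanSpace ℝ (Fin n)) (k : Fin n) : ℝ :=
  (1 / 2) * ∑ l, (fundamentalTensor F e u y)⁻¹ k l *
    ((∑ i, partialDeriv i (fun u' => partialDeriv l (fun y' => energy F e u' y') y) u * y i)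
      - partialDeriv l (fun u' => energy F e u' y) u)

/-- The geodesic spray of the Finsler function `F`, over the domain of the chart `e`. -/
def geodesicSpray (F : TangentBundle (𝓡 n) M → ℝ)
    (e : OpenPartialHomeomorph M (EuclideanSpace ℝ (Fin n)))
    (v : TangentBundle (𝓡 n) M) : TangentSpace (𝓡 n).tangent v :=
  sprayOfCoeff e (geodesicSprayCoeff F e) v

/-! ### The Levi-Civita connection of `h` in charts -/

/-- The matrix `h_{ij} = h(∂/∂xⁱ, ∂/∂xʲ)` of the Riemannian metric in the chart `e`. -/
def metricCoeff (D : NavigationData n M)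
    (e : OpenPartialHomeomorph M (EuclideanSpace ℝ (Fin n)))
    (u : EuclideanSpace ℝ (Fin n)) : Matrix (Fin n) (Fin n) ℝ :=
  Matrix.of fun i j => D.metric.inner (e.symm u)
    (tangentParam e (u, EuclideanSpace.single i 1)).2
    (tangentParam e (u, EuclideanSpace.single j 1)).2

/-- The Christoffel symbols
`Aᵏ_{ij} = ½ hᵏˡ (∂h_{jl}/∂xⁱ + ∂h_{il}/∂xʲ - ∂h_{ij}/∂xˡ)` of the Levi-Civita connection
of `h` in the chart `e`. -/
def christoffel (D : NavigationData n M)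
    (e : OpenPartialHomeomorph M (EuclideanSpace ℝ (Fin n)))
    (k i j : Fin n) (u : EuclideanSpace ℝ (Fin n)) : ℝ :=
  (1 / 2) * ∑ l, (metricCoeff D e u)⁻¹ k l *
    (partialDeriv i (fun u' => metricCoeff D e u' j l) u
      + partialDeriv j (fun u' => metricCoeff D e u' i l) u
      - partialDeriv l (fun u' => metricCoeff D e u' i j) u)

/-- The components `Wᵏ` of the wind in the chart `e`. -/
def windCoeff (D : NavigationData n M)
    (e : OpenPartialHomeomorph M (EuclideanSpace ℝ (Fin n)))
    (k : Fin n) (u : EuclideanSpace ℝ (Fin n)) : ℝ :=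
  components e (e.symm u) (D.wind (e.symm u)) k

/-- The Levi-Civita covariant derivative of the wind in the direction of the tangent vector
`X ∈ T_pM`, computed in the chart `e`: `∇_X W = Xⁱ (∂Wᵏ/∂xⁱ + Aᵏ_{ij} Wʲ) ∂/∂xᵏ`. -/
def covDerivWind (D : NavigationData n M)
    (e : OpenPartialHomeomorph M (EuclideanSpace ℝ (Fin n))) (p : M)
    (X : TangentSpace (𝓡 n) p) : EuclideanSpace ℝ (Fin n) :=
  WithLp.toLp 2 fun k => ∑ i, components e p X i *
    (partialDeriv i (windCoeff D e k) (e p)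
      + ∑ j, christoffel D e k i j (e p) * windCoeff D e j (e p))

/-- The wind is concircular: there is a smooth function `φ` on `M` with `∇_X W = φ X` for all `X`
(an identity between tangent vectors, expressed by components in every chart `e`). -/
def IsConcircular (D : NavigationData n M) : Prop :=
  ∃ φ : M → ℝ, ContMDiff (𝓡 n) 𝓘(ℝ, ℝ) ∞ φ ∧
    ∀ e ∈ IsManifold.maximalAtlas (𝓡 n) ∞ M, ∀ p ∈ e.source, ∀ X : TangentSpace (𝓡 n) p,
      covDerivWind D e p X = components e p (φ p • X)

/-! ### The Randers metric and the natural spray -/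

/-- The Randers norm function
`F(x, y) = (√(⟨y, W⟩² + λ ‖y‖²) - ⟨y, W⟩) / λ`, `λ = 1 - ‖W‖²`, of the navigation data. -/
def randers (D : NavigationData n M) (v : TangentBundle (𝓡 n) M) : ℝ :=
  let W := D.wind v.proj
  let lam := 1 - D.metric.inner v.proj W W
  √(D.metric.inner v.proj v.2 W ^ 2 + lam * D.metric.inner v.proj v.2 v.2) / lam
    - D.metric.inner v.proj v.2 W / lam

/-- The coefficients
`Gᵏ = ½ (Aᵏ_{ij} yⁱ yʲ - F yⁱ Aᵏ_{ij} Wʲ - F yⁱ ∂Wᵏ/∂xⁱ)` of the natural spray. -/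
def naturalSprayCoeff (D : NavigationData n M)
    (e : OpenPartialHomeomorph M (EuclideanSpace ℝ (Fin n)))
    (u y : EuclideanSpace ℝ (Fin n)) (k : Fin n) : ℝ :=
  (1 / 2) * ((∑ i, ∑ j, christoffel D e k i j u * y i * y j)
    - randers D (tangentParam e (u, y)) *
        (∑ i, ∑ j, y i * christoffel D e k i j u * windCoeff D e j u)
    - randers D (tangentParam e (u, y)) * ∑ i, y i * partialDeriv i (windCoeff D e k) u)

/-- The natural spray, over the domain of the chart `e`. -/
def naturalSpray (D : NavigationData n M)
    (e : OpenPartialHomeomorph M (EuclideanSpace ℝ (Fin n)))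
    (v : TangentBundle (𝓡 n) M) : TangentSpace (𝓡 n).tangent v :=
  sprayOfCoeff e (naturalSprayCoeff D e) v

end Navigation

end

/-! Write `u = y - F(y) W` for the unwound vector. The Randers norm is the positive solution of
`h(u, u) = F²`. Differentiating this relation implicitly gives `μ dF = ½ dh(u, u) + h(dy - F dW, u)`
with `μ = F + h(W, u) > 0`, so the square root in the formula for `F` never has to be differentiated
by hand.

Let `T = ∇W`. Along the natural spray `F` is constant and `u` is parallel for the Levi-Civita
connection. Substituting this into the Euler-Lagrange expression of `E = F²/2` leaves, for every
direction `c`, `(F/μ) (F h(T c, u) - ∂F(c) h(T y, u))`, where `∂F(c) = h(c, u)/μ`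
(`eulerLagrange_natural`). The fundamental tensor is positive definite (`fderiv_momentum_self_pos`),
hence invertible, so the two sprays agree at `(x, y)` exactly when this expression vanishes for all
`c`.

If `T = r · id`, it vanishes because `h(y, u) = F μ`. Conversely, every `h`-unit vector `u` is the
unwound vector of `y = u + W`, where `F(y) = 1`. Taking `c` orthogonal to `u` kills `∂F(c)` and
leaves `h(T c, u) = 0`. So `T` preserves every orthogonality relation, which makes it a homothety
(`exists_eq_smul_of_preserves_orthogonal`).

It remains to glue the pointwise factors into a smooth function. In a chart the factor is the trace
of `T` divided by `n`, hence smooth. Independence of the chart needs no transformation law for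
Christoffel symbols: the intrinsic identity `d‖W‖²(W) = 2 φ ‖W‖²` determines `φ` where `W ≠ 0`,
continuity extends this to limits of such points, and `φ = 0` wherever `W` vanishes locally. -/

noncomputable section

namespace Navigation

/-! ### Randers norms on a normed space -/

section Norm

variable {V : Type*} [NormedAddCommGroup V] [NormedSpace ℝ V]

/-- The Randers norm on `V` with inner product `b` and wind `w`. -/
def randersNorm (b : V →L[ℝ] V →L[ℝ] ℝ) (w y : V) : ℝ :=
  √(b y w ^ 2 + (1 - b w w) * b y y) / (1 - b w w) - b y w / (1 - b w w)

/-- The translate `y - F(y) w` of `y`, whose `b`-length is `F(y)`. -/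
def unwound (b : V →L[ℝ] V →L[ℝ] ℝ) (w y : V) : V := y - randersNorm b w y • w

/-- The factor `μ` in `dF(c) = b(c, y - F(y) w) / μ`. -/
def randersFactor (b : V →L[ℝ] V →L[ℝ] ℝ) (w y : V) : ℝ :=
  randersNorm b w y + b w (unwound b w y)

/-- The differential `∂F(y)` of the Randers norm. -/
def randersCovector (b : V →L[ℝ] V →L[ℝ] ℝ) (w y c : V) : ℝ :=
  b c (unwound b w y) / randersFactor b w y

variable {b : V →L[ℝ] V →L[ℝ] ℝ} {w y : V}

theorem randersFactor_eq_sqrt (hs : ∀ v z, b v z = b z v) (hw : b w w < 1) :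
    randersFactor b w y = √(b y w ^ 2 + (1 - b w w) * b y y) := by
  have : 1 - b w w ≠ 0 := by linarith
  simp only [randersFactor, unwound, randersNorm, map_sub, map_smul, smul_eq_mul, hs w y]
  field_simp
  ring

theorem radicand_pos (hp : ∀ v, v ≠ 0 → 0 < b v v) (hw : b w w < 1) (hy : y ≠ 0) :
    0 < b y w ^ 2 + (1 - b w w) * b y y := by
  have := mul_pos (sub_pos.2 hw) (hp y hy)
  positivity

theorem randersFactor_pos (hs : ∀ v z, b v z = b z v) (hp : ∀ v, v ≠ 0 → 0 < b v v)
    (hw : b w w < 1) (hy : y ≠ 0) : 0 < randersFactor b w y := by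
  rw [randersFactor_eq_sqrt hs hw]
  exact Real.sqrt_pos.2 (radicand_pos hp hw hy)

theorem randersNorm_pos (hp : ∀ v, v ≠ 0 → 0 < b v v) (hw : b w w < 1) (hy : y ≠ 0) :
    0 < randersNorm b w y := by
  rw [randersNorm, ← sub_div]
  refine div_pos (sub_pos.2 (Real.lt_sqrt_of_sq_lt ?_)) (sub_pos.2 hw)
  have := mul_pos (sub_pos.2 hw) (hp y hy)
  linarith

/-- This is the navigation equation, quadratic in `F`. It follows by squaring `μ = √(…)`, where `μ =
(1 - b w w) F + b y w`, and cancelling `1 - b w w`. -/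
theorem unwound_sq (hs : ∀ v z, b v z = b z v) (hp : ∀ v, v ≠ 0 → 0 < b v v)
    (hw : b w w < 1) (hy : y ≠ 0) :
    b (unwound b w y) (unwound b w y) = randersNorm b w y ^ 2 := by
  have h0 : 1 - b w w ≠ 0 := by linarith
  have h1 := Real.sq_sqrt (radicand_pos hp hw hy).le
  rw [← randersFactor_eq_sqrt hs hw] at h1
  simp only [randersFactor, unwound, map_sub, map_smul, smul_eq_mul, hs w y,
    sub_apply, smul_apply] at h1 ⊢
  set F := randersNorm b w y
  have : (1 - b w w) * (b y y - F * b y w - F * (b y w - F * b w w)) = (1 - b w w) * F ^ 2 := by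
    linear_combination -h1
  exact mul_left_cancel₀ h0 this

/-- Euler's relation `∂F(y) = F(y)` for the 1-homogeneous function `F`, cleared of the denominator
`μ`. -/
theorem factor_mul_norm (hs : ∀ v z, b v z = b z v) (hp : ∀ v, v ≠ 0 → 0 < b v v)
    (hw : b w w < 1) (hy : y ≠ 0) :
    b y (unwound b w y) = randersNorm b w y * randersFactor b w y := by
  have h := unwound_sq hs hp hw hy
  have : b (unwound b w y) (unwound b w y)
      = b y (unwound b w y) - randersNorm b w y * b w (unwound b w y) := by
    simp only [map_sub, map_smul, smul_eq_mul, sub_apply, smul_apply, unwound, hs w y]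
  rw [randersFactor]
  linarith

/-- The indicatrix of `F` is the unit sphere of `b` translated by `w`. This is what makes every unit
vector available as an unwound vector. -/
theorem randersNorm_add_unit {u : V} (hs : ∀ v z, b v z = b z v)
    (hp : ∀ v, v ≠ 0 → 0 < b v v) (hw : b w w < 1) (hu : b u u = 1) :
    randersNorm b w (u + w) = 1 ∧ u + w ≠ 0 := by
  have h0 : 1 - b w w ≠ 0 := by linarith
  have hne : u + w ≠ 0 := by
    intro h
    rw [eq_neg_of_add_eq_zero_left h] at hu
    simp only [map_neg, neg_apply, neg_neg] at hu
    linarith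
  -- Positivity at `u + w` reads `1 + 2 b(u, w) + b(w, w) > 0`. With `b(w, w) < 1` it gives `1 +
  -- b(u, w) > 0`, which fixes the sign of the square root below.
  have h1 := hp _ hne
  simp only [map_add, add_apply, hu, hs w u] at h1
  refine ⟨?_, hne⟩
  have h2 : b (u + w) w ^ 2 + (1 - b w w) * b (u + w) (u + w) = (1 + b u w) ^ 2 := by
    simp only [map_add, add_apply, hu, hs w u]
    ring
  rw [randersNorm, h2, Real.sqrt_sq (by linarith)]
  simp only [map_add, add_apply]
  field_simp
  ring

theorem unwound_add_unit {u : V} (hs : ∀ v z, b v z = b z v)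
    (hp : ∀ v, v ≠ 0 → 0 < b v v) (hw : b w w < 1) (hu : b u u = 1) :
    unwound b w (u + w) = u := by
  rw [unwound, (randersNorm_add_unit hs hp hw hu).1, one_smul, add_sub_cancel_right]

/-- If every vector orthogonal to `u` is mapped by `T` to a vector orthogonal to `u`,
for all `u`, then `T` is a homothety. -/
theorem exists_eq_smul_of_preserves_orthogonal {T : V →ₗ[ℝ] V}
    (hp : ∀ v, v ≠ 0 → 0 < b v v)
    (h : ∀ u c, u ≠ 0 → b c u = 0 → b (T c) u = 0) : ∃ r : ℝ, ∀ v, T v = r • v := by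
  -- Test the hypothesis on the component of `T c` orthogonal to `c`: that component is then
  -- orthogonal to both `T c` and `c`, hence to itself. So every vector is an eigenvector.
  have key : ∀ c, c ≠ 0 → T c = (b c (T c) / b c c) • c := by
    intro c hc
    have hcc := (hp c hc).ne'
    by_contra hne
    have h1 : T c - (b c (T c) / b c c) • c ≠ 0 := sub_ne_zero.2 hne
    have h2 : b c (T c - (b c (T c) / b c c) • c) = 0 := by
      simp only [map_sub, map_smul, smul_eq_mul]
      field_simp
      ring
    have h3 := h _ c h1 h2
    have h4 := hp _ h1
    rw [show b (T c - (b c (T c) / b c c) • c) = b (T c) - b ((b c (T c) / b c c) • c) from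
      map_sub _ _ _, sub_apply, h3, map_smul, smul_apply, h2, smul_zero,
      sub_zero] at h4
    exact lt_irrefl _ h4
  obtain ⟨r, hr⟩ := LinearMap.exists_eq_smul_id_of_forall_notLinearIndependent (f := T) fun v => by
    rw [LinearIndependent.pair_iff]
    by_cases hv : v = 0
    · exact fun H => one_ne_zero (H 1 0 (by simp [hv])).1
    · intro H
      have := (H (b v (T v) / b v v) (-1) (by rw [neg_one_smul, ← key v hv, add_neg_cancel])).2
      norm_num at this
  exact ⟨r, fun v => by rw [hr]; rfl⟩

/-- Implicit differentiation of the navigation equation along a curve, solved for `f'`. The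
coefficient of `f'` is the factor `μ`. -/
theorem deriv_of_unwound_sq {b : ℝ → V →L[ℝ] V →L[ℝ] ℝ} {w y : ℝ → V} {f : ℝ → ℝ}
    {b' : V →L[ℝ] V →L[ℝ] ℝ} {w' y' : V} {f' t : ℝ}
    (hb : HasDerivAt b b' t) (hw : HasDerivAt w w' t) (hy : HasDerivAt y y' t)
    (hf : HasDerivAt f f' t) (hs : ∀ v z, b t v z = b t z v)
    (h : ∀ᶠ s in nhds t, b s (y s - f s • w s) (y s - f s • w s) = f s ^ 2) :
    (f t + b t (w t) (y t - f t • w t)) * f' =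
      b' (y t - f t • w t) (y t - f t • w t) / 2 + b t (y' - f t • w') (y t - f t • w t) := by
  have hu := hy.sub (hf.smul hw)
  have h1 := ((hb.clm_apply hu).clm_apply hu).unique ((hf.pow 2).congr_of_eventuallyEq h)
  simp only [Pi.sub_apply, Pi.smul_apply', add_apply, map_sub, map_add, map_smul, smul_eq_mul,
    sub_apply, smul_apply] at h1 ⊢
  simp only [hs (w t) (y t), hs (y t) y', hs (y t) w', hs (w t) y', hs (w t) w'] at h1 ⊢
  norm_num at h1
  linear_combination (-1/2) * h1

end Norm

/-! ### Navigation data on an open subset of a normed space -/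

section Local

variable {V : Type*} [NormedAddCommGroup V] [NormedSpace ℝ V]

/-- A smooth Riemannian metric `B` and a smooth vector field `w` with `B(w, w) < 1` on the open
set `U`. -/
structure IsLocalNavigation (B : V → V →L[ℝ] V →L[ℝ] ℝ) (w : V → V) (U : Set V) : Prop where
  isOpen : IsOpen U
  contDiffOn_metric : ContDiffOn ℝ ∞ B U
  contDiffOn_wind : ContDiffOn ℝ ∞ w U
  symm : ∀ x ∈ U, ∀ v z, B x v z = B x z v
  pos : ∀ x ∈ U, ∀ v, v ≠ 0 → 0 < B x v v
  wind_lt_one : ∀ x ∈ U, B x (w x) (w x) < 1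

variable {B : V → V →L[ℝ] V →L[ℝ] ℝ} {w : V → V} {U : Set V}

variable (B w) in
/-- The Randers norm as a function on the tangent bundle of `V`. -/
def normField (z : V × V) : ℝ := randersNorm (B z.1) (w z.1) z.2

variable (B w) in
/-- The Finsler energy as a function on the tangent bundle of `V`. -/
def energyField (z : V × V) : ℝ := normField B w z ^ 2 / 2

variable (B w) in
/-- The vertical derivative of the energy in the direction `c`. -/
def momentum (c : V) (z : V × V) : ℝ :=
  normField B w z * randersCovector (B z.1) (w z.1) z.2 c

/-! ### Derivatives of the Randers norm, its energy and its momentum. -/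

namespace IsLocalNavigation

variable (H : IsLocalNavigation B w U) {x y : V}
include H

theorem differentiableAt_metric (hx : x ∈ U) : DifferentiableAt ℝ B x :=
  (H.contDiffOn_metric.contDiffAt (H.isOpen.mem_nhds hx)).differentiableAt (by simp)

theorem differentiableAt_wind (hx : x ∈ U) : DifferentiableAt ℝ w x :=
  (H.contDiffOn_wind.contDiffAt (H.isOpen.mem_nhds hx)).differentiableAt (by simp)

theorem fderiv_metric_symm (hx : x ∈ U) (a v z : V) :
    fderiv ℝ B x a v z = fderiv ℝ B x a z v := by
  have h := fun v z : V => (((H.differentiableAt_metric hx).hasFDerivAt.clm_apply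
    (hasFDerivAt_const v x)).clm_apply (hasFDerivAt_const z x))
  have h' := congrArg (fun L : V →L[ℝ] ℝ => L a) ((h v z).unique ((h z v).congr_of_eventuallyEq
    (Filter.eventually_of_mem (H.isOpen.mem_nhds hx) fun p hp => H.symm p hp v z)))
  simpa using h'

theorem differentiableAt_metric_fst (hx : x ∈ U) :
    DifferentiableAt ℝ (fun z : V × V => B z.1) (x, y) := by
  have h : DifferentiableAt ℝ B (x, y).1 := H.differentiableAt_metric hx
  exact h.comp (G := V →L[ℝ] V →L[ℝ] ℝ) (x, y)
    (differentiableAt_fst (𝕜 := ℝ) (E := V) (F := V))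

theorem differentiableAt_wind_fst (hx : x ∈ U) :
    DifferentiableAt ℝ (fun z : V × V => w z.1) (x, y) := by
  have := H.differentiableAt_wind hx
  fun_prop

theorem differentiableAt_normField (hx : x ∈ U) (hy : y ≠ 0) :
    DifferentiableAt ℝ (normField B w) (x, y) := by
  have h1 := H.differentiableAt_metric_fst (y := y) hx
  have h2 := H.differentiableAt_wind_fst (y := y) hx
  have h3 : DifferentiableAt ℝ (fun z : V × V => z.2) (x, y) := differentiableAt_snd
  have h4 : DifferentiableAt ℝ (fun z : V × V => 1 - B z.1 (w z.1) (w z.1)) (x, y) :=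
    ((h1.clm_apply h2).clm_apply h2).const_sub 1
  have h5 := sub_pos.2 (H.wind_lt_one x hx)
  have h6 := radicand_pos (H.pos x hx) (H.wind_lt_one x hx) hy
  unfold normField randersNorm
  have h7 : DifferentiableAt ℝ
      (fun z : V × V => B z.1 z.2 (w z.1) ^ 2 + (1 - B z.1 (w z.1) (w z.1)) * B z.1 z.2 z.2)
      (x, y) :=
    (((h1.clm_apply h3).clm_apply h2).pow 2).add (h4.mul ((h1.clm_apply h3).clm_apply h3))
  simp only [div_eq_mul_inv]
  have h8 := h4.inv h5.ne'
  exact ((h7.sqrt h6.ne').mul h8).sub (((h1.clm_apply h3).clm_apply h2).mul h8)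

theorem eventually_mem (hx : x ∈ U) (hy : y ≠ 0) :
    ∀ᶠ z : V × V in nhds (x, y), z.1 ∈ U ∧ z.2 ≠ 0 :=
  ((H.isOpen.preimage continuous_fst).inter
    (isOpen_compl_singleton.preimage continuous_snd)).mem_nhds ⟨hx, hy⟩

omit H in
theorem hasDerivAt_line {W : Type*} [NormedAddCommGroup W] [NormedSpace ℝ W] {f : V × V → W}
    {z : V × V} (hf : DifferentiableAt ℝ f z) (d : V × V) :
    HasDerivAt (fun s : ℝ => f (z + s • d)) (fderiv ℝ f z d) 0 := by
  have h : HasDerivAt (fun s : ℝ => z + s • d) d 0 := by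
    simpa using ((hasDerivAt_id (0 : ℝ)).smul_const d).const_add z
  have h' : HasFDerivAt f (fderiv ℝ f z) (z + (0 : ℝ) • d) := by simpa using hf.hasFDerivAt
  exact h'.comp_hasDerivAt 0 h

theorem hasDerivAt_metric_line (hx : x ∈ U) (d : V × V) :
    HasDerivAt (fun s : ℝ => B ((x, y) + s • d).1) (fderiv ℝ B x d.1) 0 := by
  have h := hasDerivAt_line (f := fun z : V × V => B z.1) (z := (x, y))
    (H.differentiableAt_metric_fst hx) d
  rwa [fderiv_fun_comp (x, y) (H.differentiableAt_metric hx) differentiableAt_fst, fderiv_fst] at h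

theorem hasDerivAt_wind_line (hx : x ∈ U) (d : V × V) :
    HasDerivAt (fun s : ℝ => w ((x, y) + s • d).1) (fderiv ℝ w x d.1) 0 := by
  have h := hasDerivAt_line (f := fun z : V × V => w z.1) (z := (x, y))
    (H.differentiableAt_wind_fst hx) d
  rwa [fderiv_fun_comp (x, y) (H.differentiableAt_wind hx) differentiableAt_fst, fderiv_fst] at h

omit H in
theorem hasDerivAt_snd_line (z d : V × V) :
    HasDerivAt (fun s : ℝ => (z + s • d).2) d.2 0 := by
  have h := hasDerivAt_line (f := fun z : V × V => z.2) (z := z) differentiableAt_snd d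
  rwa [fderiv_snd] at h

theorem fderiv_normField (hx : x ∈ U) (hy : y ≠ 0) (d : V × V) :
    fderiv ℝ (normField B w) (x, y) d =
      (fderiv ℝ B x d.1 (unwound (B x) (w x) y) (unwound (B x) (w x) y) / 2
        + B x (d.2 - normField B w (x, y) • fderiv ℝ w x d.1) (unwound (B x) (w x) y))
        / randersFactor (B x) (w x) y := by
  rw [eq_div_iff (randersFactor_pos (H.symm x hx) (H.pos x hx) (H.wind_lt_one x hx) hy).ne',
    mul_comm]
  have hc : Filter.Tendsto (fun s : ℝ => (x, y) + s • d) (nhds 0) (nhds (x, y)) := by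
    have : Continuous (fun s : ℝ => (x, y) + s • d) := by fun_prop
    simpa using this.tendsto 0
  have h := deriv_of_unwound_sq (t := 0) (H.hasDerivAt_metric_line (y := y) hx d)
    (H.hasDerivAt_wind_line (y := y) hx d) (hasDerivAt_snd_line (x, y) d)
    (hasDerivAt_line (H.differentiableAt_normField hx hy) d)
    (by simpa using H.symm x hx)
    ((hc.eventually (H.eventually_mem hx hy)).mono fun s hs =>
      unwound_sq (H.symm _ hs.1) (H.pos _ hs.1) (H.wind_lt_one _ hs.1) hs.2)
  simp only [zero_smul, add_zero] at h
  exact h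

theorem hasFDerivAt_energyField (hx : x ∈ U) (hy : y ≠ 0) :
    HasFDerivAt (energyField B w)
      (normField B w (x, y) • fderiv ℝ (normField B w) (x, y)) (x, y) := by
  have h := ((H.differentiableAt_normField hx hy).hasFDerivAt.pow 2).mul_const (1 / 2 : ℝ)
  convert! h using 1
  · ext z
    simp only [energyField]
    ring
  · ext z <;> simp <;> ring

theorem fderiv_energyField (hx : x ∈ U) (hy : y ≠ 0) (d : V × V) :
    fderiv ℝ (energyField B w) (x, y) d =
      normField B w (x, y) * fderiv ℝ (normField B w) (x, y) d := by
  rw [(H.hasFDerivAt_energyField hx hy).fderiv]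
  rfl

theorem fderiv_energyField_vertical (hx : x ∈ U) (hy : y ≠ 0) (c : V) :
    fderiv ℝ (energyField B w) (x, y) (0, c) = momentum B w c (x, y) := by
  rw [H.fderiv_energyField hx hy, H.fderiv_normField hx hy, momentum, randersCovector]
  simp

theorem differentiableAt_momentum (hx : x ∈ U) (hy : y ≠ 0) (c : V) :
    DifferentiableAt ℝ (momentum B w c) (x, y) := by
  have h1 := H.differentiableAt_metric_fst (y := y) hx
  have h2 := H.differentiableAt_wind_fst (y := y) hx
  have h3 : DifferentiableAt ℝ (fun z : V × V => z.2) (x, y) := differentiableAt_snd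
  have h4 := H.differentiableAt_normField hx hy
  have h5 := randersFactor_pos (H.symm x hx) (H.pos x hx) (H.wind_lt_one x hx) hy
  have h6 := h3.sub (h4.smul h2)
  have h7 := (h1.clm_apply (differentiableAt_const c)).clm_apply h6
  have h8 := h4.add ((h1.clm_apply h2).clm_apply h6)
  exact h4.mul (h7.mul (h8.inv h5.ne'))

/-- Product and quotient rule along the line in direction `d`, where `u'` is the derivative of the
unwound vector. Vertical `d` yields the fundamental tensor, and `d` along the natural spray yields
the Euler-Lagrange expression. -/
theorem fderiv_momentum (hx : x ∈ U) (hy : y ≠ 0) (c : V) (d : V × V) {u u' : V} {μ f f' : ℝ}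
    (hf : f = normField B w (x, y)) (hf' : f' = fderiv ℝ (normField B w) (x, y) d)
    (hu : u = unwound (B x) (w x) y) (hμ : μ = randersFactor (B x) (w x) y)
    (hu' : u' = d.2 - (f • fderiv ℝ w x d.1 + f' • w x)) :
    fderiv ℝ (momentum B w c) (x, y) d =
      f' * (B x c u / μ) + f * ((fderiv ℝ B x d.1 c u + B x c u')
        - B x c u / μ * (f' + (fderiv ℝ B x d.1 (w x) u + B x (fderiv ℝ w x d.1) u
          + B x (w x) u'))) / μ := by
  have h5 : μ ≠ 0 := by
    rw [hμ]
    exact (randersFactor_pos (H.symm x hx) (H.pos x hx) (H.wind_lt_one x hx) hy).ne'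
  have hB := H.hasDerivAt_metric_line (y := y) hx d
  have hw := H.hasDerivAt_wind_line (y := y) hx d
  have hn := hasDerivAt_line (H.differentiableAt_normField hx hy) d
  have hU : HasDerivAt (fun s : ℝ => unwound (B ((x, y) + s • d).1) (w ((x, y) + s • d).1)
      ((x, y) + s • d).2) u' 0 := by
    have h := (hasDerivAt_snd_line (x, y) d).sub (hn.smul hw)
    simp only [zero_smul, add_zero, ← hf', ← hf, ← hu'] at h
    exact h
  have hm : HasDerivAt (fun s : ℝ => randersFactor (B ((x, y) + s • d).1) (w ((x, y) + s • d).1)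
      ((x, y) + s • d).2) (f' + (fderiv ℝ B x d.1 (w x) u + B x (fderiv ℝ w x d.1) u
          + B x (w x) u')) 0 := by
    have h := hn.add ((hB.clm_apply hw).clm_apply hU)
    simp only [zero_smul, add_zero, ← hf', ← hu, add_apply] at h
    exact h
  have hc : HasDerivAt (fun s : ℝ => B ((x, y) + s • d).1 c (unwound (B ((x, y) + s • d).1)
      (w ((x, y) + s • d).1) ((x, y) + s • d).2)) (fderiv ℝ B x d.1 c u + B x c u') 0 := by
    have h := (hB.clm_apply (hasDerivAt_const (0 : ℝ) c)).clm_apply hU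
    simp only [zero_smul, add_zero, ← hu, map_zero] at h
    exact h
  have hP := hn.mul (hc.fun_div hm (by simpa only [zero_smul, add_zero, ← hμ] using h5))
  simp only [zero_smul, add_zero, ← hf, ← hu, ← hμ, ← hf'] at hP
  rw [(hasDerivAt_line (H.differentiableAt_momentum hx hy c) d).unique hP]
  field_simp

/-- Positive definiteness of the fundamental tensor. With `f = ∂F(v)` and `a = v - f w`, the
derivative of the unwound vector, the value is `f² + F (B(a, a) - f²)/μ`. -/
theorem fderiv_momentum_self_pos (hx : x ∈ U) (hy : y ≠ 0) {v : V} (hv : v ≠ 0) :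
    0 < fderiv ℝ (momentum B w v) (x, y) (0, v) := by
  have hs := H.symm x hx
  have hp := H.pos x hx
  have hl := H.wind_lt_one x hx
  have hμ := randersFactor_pos hs hp hl hy
  have hF : 0 < normField B w (x, y) := randersNorm_pos hp hl hy
  have hu2 : B x (unwound (B x) (w x) y) (unwound (B x) (w x) y) = normField B w (x, y) ^ 2 :=
    unwound_sq hs hp hl hy
  have hf' := H.fderiv_normField hx hy (0, v)
  rw [H.fderiv_momentum hx hy v (0, v) rfl rfl rfl rfl rfl]
  have hμ' : randersFactor (B x) (w x) y
    = normField B w (x, y) + B x (w x) (unwound (B x) (w x) y) := rfl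
  set u := unwound (B x) (w x) y
  set μ := randersFactor (B x) (w x) y
  set F := normField B w (x, y)
  simp only [map_zero, zero_apply, zero_div, zero_add, smul_zero, sub_zero] at hf' ⊢
  rw [hf']
  set f := B x v u / μ with hf
  have hvu : B x v u = f * μ := by rw [hf]; field_simp
  set a := v - f • w x with ha
  have h1 : B x v a - f * (f + B x (w x) a) = B x a a - f ^ 2 := by
    have : B x a a = B x v a - f * B x (w x) a := by
      have : B x a = B x v - f • B x (w x) := by rw [ha, map_sub, map_smul]
      rw [this, sub_apply, smul_apply, smul_eq_mul]
    rw [this]; ring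
  have h2 : B x a u = f * F := by
    simp only [ha, map_sub, map_smul, smul_eq_mul, sub_apply, smul_apply, hvu, hμ']
    ring
  rw [h1]
  -- Cauchy-Schwarz for `a` and `u`, since `B(a, u) = f F` and `B(u, u) = F²`; it is obtained from
  -- the nonnegative square of `F a - f u`.
  have h3 : f ^ 2 ≤ B x a a := by
    by_cases hz : F • a - f • u = 0
    · have : B x (F • a - f • u) (F • a - f • u) = 0 := by rw [hz]; simp
      simp only [map_sub, map_smul, smul_eq_mul, sub_apply, smul_apply, hs u a, h2, hu2] at this
      nlinarith [pow_pos hF 2]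
    · have := hp _ hz
      simp only [map_sub, map_smul, smul_eq_mul, sub_apply, smul_apply, hs u a, h2, hu2] at this
      nlinarith [pow_pos hF 2]
  -- Strictness: either `f² > 0`, or `f = 0` and then `a = v ≠ 0`.
  by_cases hf0 : f = 0
  · have hav : a = v := by rw [ha, hf0, zero_smul, sub_zero]
    rw [hav, hf0]
    have := hp v hv
    have : 0 < F * (B x v v) / μ := by positivity
    simpa using this
  · have : 0 ≤ F * (B x a a - f ^ 2) / μ := by
      have := sub_nonneg.2 h3
      positivity
    have : 0 < f * f := mul_self_pos.2 hf0
    linarith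

/-- Symmetry of the fundamental tensor is read off the explicit derivative, so no theorem on mixed
second derivatives is invoked. -/
theorem fderiv_momentum_vertical_comm (hx : x ∈ U) (hy : y ≠ 0) (c v : V) :
    fderiv ℝ (momentum B w c) (x, y) (0, v) = fderiv ℝ (momentum B w v) (x, y) (0, c) := by
  have hs := H.symm x hx
  rw [H.fderiv_momentum hx hy c (0, v) rfl rfl rfl rfl rfl,
    H.fderiv_momentum hx hy v (0, c) rfl rfl rfl rfl rfl, H.fderiv_normField hx hy (0, v),
    H.fderiv_normField hx hy (0, c)]
  simp only [map_zero, zero_apply, zero_div, zero_add, smul_zero, sub_zero, map_sub, map_smul,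
    smul_eq_mul, hs (w x) c, hs (w x) v, hs v c]
  ring

/-- Metric compatibility, `d‖W‖²(c) = 2 h(∇_c W, W)`. The hypothesis `hA` is the Koszul formula,
which characterises the Levi-Civita connection. -/
theorem fderiv_windSq (hx : x ∈ U) (c : V) {A : V →ₗ[ℝ] V →ₗ[ℝ] V}
    (hA : ∀ a e d, 2 * B x (A a e) d =
      fderiv ℝ B x a e d + fderiv ℝ B x e a d - fderiv ℝ B x d a e) :
    fderiv ℝ (fun x => B x (w x) (w x)) x c = 2 * B x (fderiv ℝ w x c + A c (w x)) (w x) := by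
  have hw := (H.differentiableAt_wind hx).hasFDerivAt
  rw [(((H.differentiableAt_metric hx).hasFDerivAt.clm_apply hw).clm_apply hw).fderiv]
  have h := hA c (w x) (w x)
  have hds := H.fderiv_metric_symm hx (w x) c (w x)
  simp only [map_add, add_apply, ContinuousLinearMap.comp_apply, ContinuousLinearMap.flip_apply,
    H.symm x hx (w x)]
  linarith

/-- The Euler-Lagrange expression of the Randers energy along the natural spray. -/
theorem eulerLagrange_natural (hx : x ∈ U) (hy : y ≠ 0) (c : V) {A : V →ₗ[ℝ] V →ₗ[ℝ] V}
    (hA : ∀ a e d, 2 * B x (A a e) d =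
      fderiv ℝ B x a e d + fderiv ℝ B x e a d - fderiv ℝ B x d a e) :
    fderiv ℝ (momentum B w c) (x, y)
        (y, -(A y y - normField B w (x, y) • (fderiv ℝ w x y + A y (w x))))
      - fderiv ℝ (energyField B w) (x, y) (c, 0) =
    normField B w (x, y) / randersFactor (B x) (w x) y *
      (normField B w (x, y) * B x (fderiv ℝ w x c + A c (w x)) (unwound (B x) (w x) y)
        - randersCovector (B x) (w x) y c *
          B x (fderiv ℝ w x y + A y (w x)) (unwound (B x) (w x) y)) := by
  have hs := H.symm x hx
  have hp := H.pos x hx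
  have hl := H.wind_lt_one x hx
  have hμ := randersFactor_pos hs hp hl hy
  have hF : 0 < normField B w (x, y) := randersNorm_pos hp hl hy
  have hds := H.fderiv_metric_symm hx
  have hAs : ∀ a e d, B x (A a e) d = B x (A e a) d := fun a e d => by
    linarith [hA a e d, hA e a d, hds d a e]
  rw [H.fderiv_energyField hx hy]
  have hu : unwound (B x) (w x) y = y - normField B w (x, y) • w x := rfl
  have hf' := H.fderiv_normField hx hy
    (y, -(A y y - normField B w (x, y) • (fderiv ℝ w x y + A y (w x))))
  have hfc := H.fderiv_normField hx hy (c, 0)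
  rw [H.fderiv_momentum hx hy c _ rfl rfl rfl rfl rfl, randersCovector]
  have hμ' : randersFactor (B x) (w x) y
    = normField B w (x, y) + B x (w x) (unwound (B x) (w x) y) := rfl
  set u := unwound (B x) (w x) y
  set μ := randersFactor (B x) (w x) y
  set F := normField B w (x, y)
  set T := fderiv ℝ w x y + A y (w x) with hT
  have hAu : ∀ a, A a u = A a y - F • A a (w x) := fun a => by rw [hu, map_sub, map_smul]
  have hcompat : ∀ a e d, fderiv ℝ B x a e d = B x (A a e) d + B x e (A a d) := fun a e d => by
    rw [hs e]
    linarith [hA a e d, hA a d e, hds a e d, hds e a d, hds d a e]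
  -- The natural spray preserves `F`.
  have hz : fderiv ℝ (normField B w) (x, y) (y, -(A y y - F • T)) = 0 := by
    rw [hf']
    simp only [hcompat, hs u, hT, hAu, map_sub, map_neg, map_add, map_smul, smul_eq_mul,
      sub_apply, neg_apply, add_apply, smul_apply]
    ring
  -- The unwound vector is parallel along the natural spray; the coefficient `0` is the derivative
  -- of `F` just found.
  have hu' : -(A y y - F • T) - (F • fderiv ℝ w x y + (0 : ℝ) • w x) = -A y u := by
    rw [hAu, hT, smul_add, zero_smul]
    abel
  have hcu : fderiv ℝ B x c u u = 2 * (B x (A y c) u - F * B x (A c (w x)) u) := by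
    rw [hcompat, hs u, hAu, hAs y c]
    simp only [map_sub, map_smul, smul_eq_mul, sub_apply, smul_apply]
    ring
  simp only [hz, hfc, hu', hcu, hcompat y, zero_sub, zero_mul, zero_add]
  simp only [hT, map_neg, map_add, map_smul, smul_eq_mul, neg_apply, add_apply, smul_apply]
  field_simp
  ring

end IsLocalNavigation
end Local

/-! ### Navigation data in a chart -/

section Chart

variable {n : ℕ} {M : Type*} [TopologicalSpace M] [ChartedSpace (EuclideanSpace ℝ (Fin n)) M]
  [IsManifold (𝓡 n) ∞ M]

/-- The differential of the inverse of the chart `e`. -/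
def symmDeriv (e : OpenPartialHomeomorph M (EuclideanSpace ℝ (Fin n)))
    (u : EuclideanSpace ℝ (Fin n)) :
    EuclideanSpace ℝ (Fin n) →L[ℝ] EuclideanSpace ℝ (Fin n) :=
  mfderiv (𝓡 n) (𝓡 n) e.symm u

/-- The metric in the chart `e`. -/
def localMetric (D : NavigationData n M)
    (e : OpenPartialHomeomorph M (EuclideanSpace ℝ (Fin n))) (u : EuclideanSpace ℝ (Fin n)) :
    EuclideanSpace ℝ (Fin n) →L[ℝ] EuclideanSpace ℝ (Fin n) →L[ℝ] ℝ :=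
  ContinuousLinearMap.bilinearComp (E := EuclideanSpace ℝ (Fin n)) (F := EuclideanSpace ℝ (Fin n))
    (D.metric.inner (e.symm u)) (symmDeriv e u) (symmDeriv e u)

/-- The wind in the chart `e`. -/
def localWind (D : NavigationData n M)
    (e : OpenPartialHomeomorph M (EuclideanSpace ℝ (Fin n))) (u : EuclideanSpace ℝ (Fin n)) :
    EuclideanSpace ℝ (Fin n) :=
  components e (e.symm u) (D.wind (e.symm u))

variable {D : NavigationData n M} {e : OpenPartialHomeomorph M (EuclideanSpace ℝ (Fin n))}
  {u : EuclideanSpace ℝ (Fin n)}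

theorem localMetric_apply (y z : EuclideanSpace ℝ (Fin n)) :
    localMetric D e u y z = D.metric.inner (e.symm u) (symmDeriv e u y) (symmDeriv e u z) := rfl

theorem metricCoeff_eq (i j : Fin n) :
    metricCoeff D e u i j =
      localMetric D e u (EuclideanSpace.single i 1) (EuclideanSpace.single j 1) := rfl

theorem windCoeff_eq (k : Fin n) : windCoeff D e k u = localWind D e u k := rfl

omit [IsManifold (𝓡 n) ∞ M] in
theorem mdifferentiable_of_mem_maximalAtlas
    (he : e ∈ IsManifold.maximalAtlas (𝓡 n) ∞ M) : e.MDifferentiable (𝓡 n) (𝓡 n) :=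
  ⟨(contMDiffOn_of_mem_maximalAtlas he).mdifferentiableOn (by simp),
    (contMDiffOn_symm_of_mem_maximalAtlas he).mdifferentiableOn (by simp)⟩

omit [IsManifold (𝓡 n) ∞ M] in
theorem symmDeriv_components (he : e ∈ IsManifold.maximalAtlas (𝓡 n) ∞ M) (hu : u ∈ e.target)
    (X : TangentSpace (𝓡 n) (e.symm u)) : symmDeriv e u (components e (e.symm u) X) = X := by
  have h := (mdifferentiable_of_mem_maximalAtlas he).symm_comp_deriv (e.map_target hu)
  have h' : symmDeriv e (e (e.symm u)) (components e (e.symm u) X) = X :=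
    congrArg (fun L => L X) h
  rw [e.right_inv hu] at h'
  exact h'

omit [IsManifold (𝓡 n) ∞ M] in
theorem components_symmDeriv (he : e ∈ IsManifold.maximalAtlas (𝓡 n) ∞ M) (hu : u ∈ e.target)
    (y : EuclideanSpace ℝ (Fin n)) : components e (e.symm u) (symmDeriv e u y) = y :=
  congrArg (fun L => L y) ((mdifferentiable_of_mem_maximalAtlas he).comp_symm_deriv hu)

omit [IsManifold (𝓡 n) ∞ M] in
theorem tangentParam_eq (y : EuclideanSpace ℝ (Fin n)) :
    tangentParam e (u, y) = ⟨e.symm u, symmDeriv e u y⟩ := rfl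

theorem randers_tangentParam (he : e ∈ IsManifold.maximalAtlas (𝓡 n) ∞ M) (hu : u ∈ e.target)
    (y : EuclideanSpace ℝ (Fin n)) :
    randers D (tangentParam e (u, y)) = normField (localMetric D e) (localWind D e) (u, y) := by
  have h : symmDeriv e u (localWind D e u) = D.wind (e.symm u) := symmDeriv_components he hu _
  simp only [randers, tangentParam_eq, normField, randersNorm, localMetric_apply, h]
  rfl

/-- Identifies `E × E` smoothly with the tangent bundle of `E`, which turns `tangentParam e` into
the tangent map of `e.symm`. -/
theorem contMDiff_mk_tangentBundle {m : WithTop ℕ∞} :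
    ContMDiff 𝓘(ℝ, EuclideanSpace ℝ (Fin n) × EuclideanSpace ℝ (Fin n)) (𝓡 n).tangent m
      (fun z : EuclideanSpace ℝ (Fin n) × EuclideanSpace ℝ (Fin n) =>
        (⟨z.1, z.2⟩ : TangentBundle (𝓡 n) (EuclideanSpace ℝ (Fin n)))) := by
  intro z
  rw [Bundle.contMDiffAt_totalSpace]
  refine ⟨contDiff_fst.contMDiff.contMDiffAt, ?_⟩
  simp
  exact contDiff_snd.contMDiff.contMDiffAt

theorem contMDiffOn_tangentParam (he : e ∈ IsManifold.maximalAtlas (𝓡 n) ∞ M) :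
    ContMDiffOn 𝓘(ℝ, EuclideanSpace ℝ (Fin n) × EuclideanSpace ℝ (Fin n)) (𝓡 n).tangent ∞
      (tangentParam e) (Prod.fst ⁻¹' e.target) := by
  have h := (contMDiffOn_symm_of_mem_maximalAtlas he).contMDiffOn_tangentMapWithin (m := ∞)
    (by simp) e.open_target.uniqueMDiffOn
  refine ((h.comp contMDiff_mk_tangentBundle.contMDiffOn (fun z hz => hz))).congr ?_
  intro z hz
  simp only [Function.comp, tangentMapWithin, tangentParam]
  rw [mfderivWithin_of_isOpen e.open_target hz]

theorem contMDiffAt_tangentParam_left (he : e ∈ IsManifold.maximalAtlas (𝓡 n) ∞ M)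
    (hu : u ∈ e.target) (y : EuclideanSpace ℝ (Fin n)) :
    ContMDiffAt (𝓡 n) (𝓡 n).tangent ∞ (fun u => tangentParam e (u, y)) u := by
  have h := (contMDiffOn_tangentParam he).contMDiffAt (x := (u, y))
    ((e.open_target.preimage continuous_fst).mem_nhds hu)
  exact h.comp u (contDiff_prodMk_left y).contMDiff.contMDiffAt

theorem contDiffOn_localMetric_apply (he : e ∈ IsManifold.maximalAtlas (𝓡 n) ∞ M)
    (y z : EuclideanSpace ℝ (Fin n)) :
    ContDiffOn ℝ ∞ (fun u => localMetric D e u y z) e.target := by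
  rw [← contMDiffOn_iff_contDiffOn]
  intro u hu
  have h1 := fun y => contMDiffAt_tangentParam_left he hu y
  have h2 := (contMDiffOn_symm_of_mem_maximalAtlas he).contMDiffAt (e.open_target.mem_nhds hu)
  have h3 := D.metric.contMDiff.contMDiffAt.comp u h2
  have h4 : ContMDiffAt (𝓡 n) ((𝓡 n).prod 𝓘(ℝ)) ∞
      (fun u ↦ Bundle.TotalSpace.mk' ℝ (E := Bundle.Trivial M ℝ) (e.symm u)
        (D.metric.inner (e.symm u) (tangentParam e (u, y)).2 (tangentParam e (u, z)).2)) u :=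
    ContMDiffAt.clm_bundle_apply₂ (F₁ := EuclideanSpace ℝ (Fin n))
      (F₂ := EuclideanSpace ℝ (Fin n)) h3 (h1 y) (h1 z)
  exact (Bundle.contMDiffAt_totalSpace.1 h4).2.contMDiffWithinAt

theorem contDiffOn_localMetric (he : e ∈ IsManifold.maximalAtlas (𝓡 n) ∞ M) :
    ContDiffOn ℝ ∞ (localMetric D e) e.target :=
  contDiffOn_clm_apply.2 fun y => contDiffOn_clm_apply.2 fun z =>
    contDiffOn_localMetric_apply he y z

theorem contDiffOn_localWind (he : e ∈ IsManifold.maximalAtlas (𝓡 n) ∞ M) :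
    ContDiffOn ℝ ∞ (localWind D e) e.target := by
  rw [← contMDiffOn_iff_contDiffOn]
  have h := (contMDiffOn_of_mem_maximalAtlas he).contMDiffOn_tangentMapWithin (m := ∞)
    (by simp) e.open_source.uniqueMDiffOn
  have h2 := h.comp (D.contMDiff_wind.comp_contMDiffOn (contMDiffOn_symm_of_mem_maximalAtlas he))
    (fun x hx => e.map_target hx)
  have h3 := (contMDiff_snd_tangentBundle_modelSpace (EuclideanSpace ℝ (Fin n)) (𝓡 n)
    (n := ∞)).comp_contMDiffOn h2
  refine ContMDiffOn.congr h3 fun x hx => ?_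
  simp only [Function.comp, tangentMapWithin, localWind, components]
  rw [mfderivWithin_of_isOpen e.open_source (e.map_target hx)]

theorem localMetric_pos (he : e ∈ IsManifold.maximalAtlas (𝓡 n) ∞ M) (hu : u ∈ e.target)
    {v : EuclideanSpace ℝ (Fin n)} (hv : v ≠ 0) : 0 < localMetric D e u v v := by
  have h : symmDeriv e u v ≠ 0 := fun h => hv <| by
    have h' := components_symmDeriv he hu v
    rw [h] at h'
    exact h'.symm.trans (map_zero (mfderiv (𝓡 n) (𝓡 n) e (e.symm u)))
  exact D.metric.pos (e.symm u) (symmDeriv e u v) h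

theorem localMetric_localWind_lt_one (he : e ∈ IsManifold.maximalAtlas (𝓡 n) ∞ M)
    (hu : u ∈ e.target) : localMetric D e u (localWind D e u) (localWind D e u) < 1 := by
  have h : symmDeriv e u (localWind D e u) = D.wind (e.symm u) := symmDeriv_components he hu _
  rw [localMetric_apply, h]
  exact D.norm_wind_lt_one _

theorem isLocalNavigation (he : e ∈ IsManifold.maximalAtlas (𝓡 n) ∞ M) :
    IsLocalNavigation (localMetric D e) (localWind D e) e.target where
  isOpen := e.open_target
  contDiffOn_metric := contDiffOn_localMetric he
  contDiffOn_wind := contDiffOn_localWind he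
  symm x _ v z := D.metric.symm (e.symm x) (symmDeriv e x v) (symmDeriv e x z)
  pos _ hx _ hv := localMetric_pos he hx hv
  wind_lt_one _ hx := localMetric_localWind_lt_one he hx

end Chart

/-! ### Comparing sprays on the tangent bundle through their coefficients. -/

section Spray

variable {n : ℕ} {M : Type*} [TopologicalSpace M] [ChartedSpace (EuclideanSpace ℝ (Fin n)) M]
  [IsManifold (𝓡 n) ∞ M] {e : OpenPartialHomeomorph M (EuclideanSpace ℝ (Fin n))}

/-- The chart of `TM` induced by the chart `e` of `M`. -/
def tangentCoord (e : OpenPartialHomeomorph M (EuclideanSpace ℝ (Fin n)))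
    (v : TangentBundle (𝓡 n) M) : EuclideanSpace ℝ (Fin n) × EuclideanSpace ℝ (Fin n) :=
  (e v.proj, components e v.proj v.2)

theorem contMDiffOn_tangentCoord (he : e ∈ IsManifold.maximalAtlas (𝓡 n) ∞ M) :
    ContMDiffOn (𝓡 n).tangent 𝓘(ℝ, EuclideanSpace ℝ (Fin n) × EuclideanSpace ℝ (Fin n)) ∞
      (tangentCoord e) (Bundle.TotalSpace.proj ⁻¹' e.source) := by
  have h := (contMDiffOn_of_mem_maximalAtlas he).contMDiffOn_tangentMapWithin (m := ∞)
    (by simp) e.open_source.uniqueMDiffOn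
  have h1 := (contMDiffOn_of_mem_maximalAtlas he).comp
    (Bundle.contMDiff_proj (F := EuclideanSpace ℝ (Fin n)) (TangentSpace (𝓡 n) (M := M)) (n := ∞)
      (IB := 𝓡 n)).contMDiffOn
    (s := Bundle.TotalSpace.proj ⁻¹' e.source) (fun x hx => hx)
  have h2 := (contMDiff_snd_tangentBundle_modelSpace (EuclideanSpace ℝ (Fin n)) (𝓡 n)
    (n := ∞)).comp_contMDiffOn h
  refine (h1.prodMk_space (h2.congr (f₁ := fun v => components e v.proj v.2) fun x hx => ?_))
  simp only [Function.comp, tangentMapWithin, components]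
  rw [mfderivWithin_of_isOpen e.open_source hx]

omit [IsManifold (𝓡 n) ∞ M] in
theorem tangentCoord_tangentParam (he : e ∈ IsManifold.maximalAtlas (𝓡 n) ∞ M)
    {z : EuclideanSpace ℝ (Fin n) × EuclideanSpace ℝ (Fin n)} (hz : z.1 ∈ e.target) :
    tangentCoord e (tangentParam e z) = z :=
  Prod.ext (e.right_inv hz) (components_symmDeriv he hz z.2)

/-- `tangentCoord e` is a smooth local left inverse, so its differential is a left inverse of this
one. -/
theorem injective_mfderiv_tangentParam (he : e ∈ IsManifold.maximalAtlas (𝓡 n) ∞ M)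
    {z : EuclideanSpace ℝ (Fin n) × EuclideanSpace ℝ (Fin n)} (hz : z.1 ∈ e.target) :
    Function.Injective (mfderiv 𝓘(ℝ, EuclideanSpace ℝ (Fin n) × EuclideanSpace ℝ (Fin n))
      (𝓡 n).tangent (tangentParam e) z) := by
  have hn : Prod.fst ⁻¹' e.target ∈ nhds z :=
    (e.open_target.preimage continuous_fst).mem_nhds hz
  have h1 := ((contMDiffOn_tangentParam he).contMDiffAt hn).mdifferentiableAt (by simp)
  have h2 := ((contMDiffOn_tangentCoord he).contMDiffAt (x := tangentParam e z)
    ((e.open_source.preimage (FiberBundle.continuous_proj _ _)).mem_nhds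
      (e.map_target hz))).mdifferentiableAt (by simp)
  have h3 := (h2.hasMFDerivAt.comp z h1.hasMFDerivAt).congr_of_eventuallyEq
    (Filter.eventually_of_mem hn fun x hx => (tangentCoord_tangentParam he hx).symm)
  have h4 := hasMFDerivAt_unique h3 (hasMFDerivAt_id z)
  refine Function.LeftInverse.injective (g := mfderiv (𝓡 n).tangent
    𝓘(ℝ, EuclideanSpace ℝ (Fin n) × EuclideanSpace ℝ (Fin n)) (tangentCoord e)
    (tangentParam e z)) fun X => ?_
  exact congrArg (fun L => L X) h4

theorem sprayOfCoeff_eq_iff (he : e ∈ IsManifold.maximalAtlas (𝓡 n) ∞ M)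
    {G G' : EuclideanSpace ℝ (Fin n) → EuclideanSpace ℝ (Fin n) → Fin n → ℝ}
    {v : TangentBundle (𝓡 n) M} (hv : v.proj ∈ e.source) :
    sprayOfCoeff e G v = sprayOfCoeff e G' v ↔
      G (e v.proj) (components e v.proj v.2) = G' (e v.proj) (components e v.proj v.2) := by
  constructor
  · intro h
    have h1 := injective_mfderiv_tangentParam he
      (z := (e v.proj, components e v.proj v.2)) (e.map_source hv) h
    ext k
    have h2 := congrArg (fun q : EuclideanSpace ℝ (Fin n) × EuclideanSpace ℝ (Fin n) => q.2 k) h1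
    simpa using h2
  · intro h
    simp only [sprayOfCoeff, h]
    rfl

end Spray

/-! ### Christoffel symbols, the natural spray and the geodesic spray in coordinates. -/

section Coordinates

variable {n : ℕ} {M : Type*} [TopologicalSpace M] [ChartedSpace (EuclideanSpace ℝ (Fin n)) M]
  [IsManifold (𝓡 n) ∞ M] {D : NavigationData n M}
  {e : OpenPartialHomeomorph M (EuclideanSpace ℝ (Fin n))} {u y : EuclideanSpace ℝ (Fin n)}

theorem sum_smul_single (y : EuclideanSpace ℝ (Fin n)) :
    ∑ i, y i • EuclideanSpace.single i (1 : ℝ) = y := by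
  ext k
  simp [Finset.sum_apply, Pi.single_apply]

theorem map_eq_sum {W : Type*} [AddCommMonoid W] [Module ℝ W]
    (L : EuclideanSpace ℝ (Fin n) →ₗ[ℝ] W) (y : EuclideanSpace ℝ (Fin n)) :
    L y = ∑ i, y i • L (EuclideanSpace.single i 1) := by
  conv_lhs => rw [← sum_smul_single y]
  simp only [map_sum, map_smul]

theorem eq_of_single {f g : EuclideanSpace ℝ (Fin n) → ℝ} (hf : IsLinearMap ℝ f)
    (hg : IsLinearMap ℝ g)
    (h : ∀ i, f (EuclideanSpace.single i 1) = g (EuclideanSpace.single i 1))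
    (y : EuclideanSpace ℝ (Fin n)) : f y = g y := by
  refine (map_eq_sum (hf.mk' f) y).trans (Eq.trans ?_ (map_eq_sum (hg.mk' g) y).symm)
  exact Finset.sum_congr rfl fun i _ => congrArg (y i • ·) (h i)

theorem partialDeriv_metricCoeff (he : e ∈ IsManifold.maximalAtlas (𝓡 n) ∞ M)
    (hu : u ∈ e.target) (i j l : Fin n) :
    partialDeriv l (fun u' => metricCoeff D e u' i j) u =
      fderiv ℝ (localMetric D e) u (EuclideanSpace.single l 1) (EuclideanSpace.single i 1)
        (EuclideanSpace.single j 1) := by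
  have h := ((((isLocalNavigation (D := D) he).differentiableAt_metric hu).hasFDerivAt.clm_apply
      (hasFDerivAt_const (EuclideanSpace.single i 1) u)).clm_apply
      (hasFDerivAt_const (EuclideanSpace.single j 1) u)).fderiv
  simp only [metricCoeff_eq, partialDeriv]
  rw [h]
  simp

theorem partialDeriv_windCoeff (he : e ∈ IsManifold.maximalAtlas (𝓡 n) ∞ M)
    (hu : u ∈ e.target) (i k : Fin n) :
    partialDeriv i (windCoeff D e k) u =
      fderiv ℝ (localWind D e) u (EuclideanSpace.single i 1) k := by
  have h := ((EuclideanSpace.proj (𝕜 := ℝ) k).hasFDerivAt.comp u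
    ((isLocalNavigation (D := D) he).differentiableAt_wind hu).hasFDerivAt).fderiv
  rw [partialDeriv, show windCoeff D e k = (EuclideanSpace.proj (𝕜 := ℝ) k) ∘ localWind D e from rfl,
    h]
  rfl

variable (D e u) in
/-- The Christoffel symbols as a bilinear map. -/
def christoffelMap : EuclideanSpace ℝ (Fin n) →ₗ[ℝ] EuclideanSpace ℝ (Fin n) →ₗ[ℝ]
    EuclideanSpace ℝ (Fin n) :=
  LinearMap.mk₂ ℝ
    (fun a c => WithLp.toLp 2 fun k => ∑ i, ∑ j, christoffel D e k i j u * a i * c j)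
    (fun a b c => by
      ext k
      simp [← Finset.sum_add_distrib, mul_add, add_mul])
    (fun r a c => by
      ext k
      simp only [PiLp.smul_apply, smul_eq_mul, Finset.mul_sum]
      exact Finset.sum_congr rfl fun i _ => Finset.sum_congr rfl fun j _ => by ring)
    (fun a b c => by
      ext k
      simp [← Finset.sum_add_distrib, mul_add])
    (fun r a c => by
      ext k
      simp only [PiLp.smul_apply, smul_eq_mul, Finset.mul_sum]
      exact Finset.sum_congr rfl fun i _ => Finset.sum_congr rfl fun j _ => by ring)

theorem christoffelMap_apply (a c : EuclideanSpace ℝ (Fin n)) (k : Fin n) :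
    christoffelMap D e u a c k = ∑ i, ∑ j, christoffel D e k i j u * a i * c j := rfl

theorem localMetric_eq_sum (a c : EuclideanSpace ℝ (Fin n)) :
    localMetric D e u a c = ∑ i, ∑ j, a i * c j * metricCoeff D e u i j := by
  rw [show localMetric D e u a = ∑ i, a i • localMetric D e u (EuclideanSpace.single i 1) from
    map_eq_sum (localMetric D e u).toLinearMap a]
  simp only [sum_apply, smul_apply, smul_eq_mul, metricCoeff_eq]
  refine Finset.sum_congr rfl fun i _ => ?_
  rw [show localMetric D e u (EuclideanSpace.single i 1) c =
    ∑ j, c j • localMetric D e u (EuclideanSpace.single i 1) (EuclideanSpace.single j 1) from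
    map_eq_sum (localMetric D e u (EuclideanSpace.single i 1)).toLinearMap c, Finset.mul_sum]
  simp only [smul_eq_mul, mul_assoc]

theorem isUnit_of_pos {A : Matrix (Fin n) (Fin n) ℝ}
    (hA : ∀ v : EuclideanSpace ℝ (Fin n), v ≠ 0 → 0 < ∑ i, ∑ j, v i * v j * A i j) :
    IsUnit A.det := by
  rw [isUnit_iff_ne_zero]
  intro h
  obtain ⟨v, hv, hAv⟩ := Matrix.exists_mulVec_eq_zero_iff.2 h
  have h1 := hA (WithLp.toLp 2 v) fun h => hv <| by
    ext k; exact congrArg (fun z : EuclideanSpace ℝ (Fin n) => z k) h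
  have h2 : ∑ i, ∑ j, v i * v j * A i j = v ⬝ᵥ A.mulVec v := by
    simp only [dotProduct, Matrix.mulVec, Finset.mul_sum]
    exact Finset.sum_congr rfl fun i _ => Finset.sum_congr rfl fun j _ => by ring
  rw [hAv, dotProduct_zero] at h2
  exact h1.ne' h2

theorem isUnit_metricCoeff (he : e ∈ IsManifold.maximalAtlas (𝓡 n) ∞ M) (hu : u ∈ e.target) :
    IsUnit (metricCoeff D e u).det :=
  isUnit_of_pos fun v hv => by
    rw [← localMetric_eq_sum]
    exact localMetric_pos he hu hv

theorem christoffelMap_single (he : e ∈ IsManifold.maximalAtlas (𝓡 n) ∞ M) (hu : u ∈ e.target)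
    (i j m : Fin n) :
    2 * localMetric D e u (christoffelMap D e u (EuclideanSpace.single i 1)
      (EuclideanSpace.single j 1)) (EuclideanSpace.single m 1) =
      partialDeriv i (fun u' => metricCoeff D e u' j m) u
      + partialDeriv j (fun u' => metricCoeff D e u' i m) u
      - partialDeriv m (fun u' => metricCoeff D e u' i j) u := by
  have hsymm : ∀ k, metricCoeff D e u k m = metricCoeff D e u m k := fun k =>
    (isLocalNavigation he).symm u hu _ _
  set q : Fin n → ℝ := fun m => partialDeriv i (fun u' => metricCoeff D e u' j m) u
      + partialDeriv j (fun u' => metricCoeff D e u' i m) u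
      - partialDeriv m (fun u' => metricCoeff D e u' i j) u with hq
  have h1 : ∀ k, christoffelMap D e u (EuclideanSpace.single i 1) (EuclideanSpace.single j 1) k
      = ((1 / 2 : ℝ) • ((metricCoeff D e u)⁻¹).mulVec q) k := fun k => by
    simp [christoffelMap_apply, christoffel, Matrix.mulVec, dotProduct, hq]
  have h2 : localMetric D e u (christoffelMap D e u (EuclideanSpace.single i 1)
      (EuclideanSpace.single j 1)) (EuclideanSpace.single m 1)
      = (metricCoeff D e u).mulVec ((1 / 2 : ℝ) • ((metricCoeff D e u)⁻¹).mulVec q) m := by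
    rw [localMetric_eq_sum]
    simp only [Matrix.mulVec, dotProduct, ← h1, ← hsymm]
    simp [mul_comm]
  rw [h2, Matrix.mulVec_smul, Matrix.mulVec_mulVec,
    Matrix.mul_nonsing_inv _ (isUnit_metricCoeff he hu), Matrix.one_mulVec]
  simp [hq]

/-- The Koszul formula. Both sides are trilinear, so basis vectors suffice, one slot at a time;
there the metric matrix cancels its inverse in the Christoffel symbols. -/
theorem christoffelMap_spec (he : e ∈ IsManifold.maximalAtlas (𝓡 n) ∞ M) (hu : u ∈ e.target)
    (a c d : EuclideanSpace ℝ (Fin n)) :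
    2 * localMetric D e u (christoffelMap D e u a c) d =
      fderiv ℝ (localMetric D e) u a c d + fderiv ℝ (localMetric D e) u c a d
        - fderiv ℝ (localMetric D e) u d a c := by
  refine eq_of_single (f := fun d => 2 * localMetric D e u (christoffelMap D e u a c) d)
    (g := fun d => fderiv ℝ (localMetric D e) u a c d + fderiv ℝ (localMetric D e) u c a d
        - fderiv ℝ (localMetric D e) u d a c)
    ⟨fun _ _ => by simp; ring, fun _ _ => by simp; ring⟩
    ⟨fun _ _ => by simp; ring, fun _ _ => by simp; ring⟩ (fun m => ?_) d
  set d := EuclideanSpace.single m (1 : ℝ) with hd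
  refine eq_of_single (f := fun c => 2 * localMetric D e u (christoffelMap D e u a c) d)
    (g := fun c => fderiv ℝ (localMetric D e) u a c d + fderiv ℝ (localMetric D e) u c a d
        - fderiv ℝ (localMetric D e) u d a c)
    ⟨fun _ _ => by simp; ring, fun _ _ => by simp; ring⟩
    ⟨fun _ _ => by simp; ring, fun _ _ => by simp; ring⟩ (fun j => ?_) c
  set c := EuclideanSpace.single j (1 : ℝ) with hc
  refine eq_of_single (f := fun a => 2 * localMetric D e u (christoffelMap D e u a c) d)
    (g := fun a => fderiv ℝ (localMetric D e) u a c d + fderiv ℝ (localMetric D e) u c a d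
        - fderiv ℝ (localMetric D e) u d a c)
    ⟨fun _ _ => by simp; ring, fun _ _ => by simp; ring⟩
    ⟨fun _ _ => by simp; ring, fun _ _ => by simp; ring⟩ (fun i => ?_) a
  simp only [hc, hd, christoffelMap_single he hu, partialDeriv_metricCoeff he hu]

variable (D e u) in
/-- The covariant differential of the wind in the chart `e`. -/
def covDeriv : EuclideanSpace ℝ (Fin n) →ₗ[ℝ] EuclideanSpace ℝ (Fin n) :=
  (fderiv ℝ (localWind D e) u).toLinearMap + (christoffelMap D e u).flip (localWind D e u)

theorem covDeriv_apply (a : EuclideanSpace ℝ (Fin n)) :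
    covDeriv D e u a = fderiv ℝ (localWind D e) u a + christoffelMap D e u a (localWind D e u) :=
  rfl

theorem naturalSprayCoeff_eq (he : e ∈ IsManifold.maximalAtlas (𝓡 n) ∞ M) (hu : u ∈ e.target)
    (y : EuclideanSpace ℝ (Fin n)) (k : Fin n) :
    naturalSprayCoeff D e u y k = ((1 / 2 : ℝ) • (christoffelMap D e u y y
      - normField (localMetric D e) (localWind D e) (u, y) • covDeriv D e u y)) k := by
  rw [naturalSprayCoeff, randers_tangentParam he hu]
  simp only [partialDeriv_windCoeff he hu]
  have h : (fderiv ℝ (localWind D e) u) y k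
      = ∑ i, y i * (fderiv ℝ (localWind D e) u (EuclideanSpace.single i 1)) k :=
    map_eq_sum ((EuclideanSpace.proj (𝕜 := ℝ) k).comp (fderiv ℝ (localWind D e) u)).toLinearMap y
  simp only [PiLp.smul_apply, PiLp.sub_apply, PiLp.add_apply, covDeriv_apply, christoffelMap_apply,
    smul_eq_mul, h, windCoeff_eq]
  simp only [mul_comm (y _) (christoffel _ _ _ _ _ _)]
  ring

theorem energy_eq (he : e ∈ IsManifold.maximalAtlas (𝓡 n) ∞ M) (hu : u ∈ e.target)
    (y : EuclideanSpace ℝ (Fin n)) :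
    energy (randers D) e u y = energyField (localMetric D e) (localWind D e) (u, y) := by
  rw [energy, randers_tangentParam he hu, energyField]

theorem partialDeriv_right {f : EuclideanSpace ℝ (Fin n) × EuclideanSpace ℝ (Fin n) → ℝ}
    (hf : DifferentiableAt ℝ f (u, y)) (j : Fin n) :
    partialDeriv j (fun y' => f (u, y')) y = fderiv ℝ f (u, y) (0, EuclideanSpace.single j 1) := by
  have h := (hf.hasFDerivAt.comp y (hasFDerivAt_prodMk_right u y)).fderiv
  rw [partialDeriv, show (fun y' => f (u, y')) = f ∘ fun y' => (u, y') from rfl, h]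
  simp

theorem partialDeriv_left {f : EuclideanSpace ℝ (Fin n) × EuclideanSpace ℝ (Fin n) → ℝ}
    (hf : DifferentiableAt ℝ f (u, y)) (j : Fin n) :
    partialDeriv j (fun u' => f (u', y)) u = fderiv ℝ f (u, y) (EuclideanSpace.single j 1, 0) := by
  have h := (HasFDerivAt.comp (f := fun u' => (u', y)) u hf.hasFDerivAt
    (hasFDerivAt_prodMk_left u y)).fderiv
  rw [partialDeriv, show (fun u' => f (u', y)) = f ∘ fun u' => (u', y) from rfl, h]
  simp

theorem partialDeriv_congr {f g : EuclideanSpace ℝ (Fin n) → ℝ} (h : f =ᶠ[nhds u] g)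
    (j : Fin n) : partialDeriv j f u = partialDeriv j g u := by
  rw [partialDeriv, h.fderiv_eq, partialDeriv]

theorem partialDeriv_energy_right (he : e ∈ IsManifold.maximalAtlas (𝓡 n) ∞ M)
    (hu : u ∈ e.target) (hy : y ≠ 0) (j : Fin n) :
    partialDeriv j (fun y' => energy (randers D) e u y') y =
      momentum (localMetric D e) (localWind D e) (EuclideanSpace.single j 1) (u, y) := by
  have H := isLocalNavigation (D := D) he
  simp only [energy_eq he hu]
  rw [partialDeriv_right (f := energyField (localMetric D e) (localWind D e))
    (H.hasFDerivAt_energyField hu hy).differentiableAt, H.fderiv_energyField_vertical hu hy]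

theorem partialDeriv_energy_left (he : e ∈ IsManifold.maximalAtlas (𝓡 n) ∞ M)
    (hu : u ∈ e.target) (hy : y ≠ 0) (j : Fin n) :
    partialDeriv j (fun u' => energy (randers D) e u' y) u =
      fderiv ℝ (energyField (localMetric D e) (localWind D e)) (u, y)
        (EuclideanSpace.single j 1, 0) := by
  rw [← partialDeriv_left
    ((isLocalNavigation (D := D) he).hasFDerivAt_energyField hu hy).differentiableAt]
  exact partialDeriv_congr (Filter.eventually_of_mem (e.open_target.mem_nhds hu)
    fun u' hu' => energy_eq he hu' y) j

theorem fundamentalTensor_eq (he : e ∈ IsManifold.maximalAtlas (𝓡 n) ∞ M)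
    (hu : u ∈ e.target) (hy : y ≠ 0) (i j : Fin n) :
    fundamentalTensor (randers D) e u y i j =
      fderiv ℝ (momentum (localMetric D e) (localWind D e) (EuclideanSpace.single j 1)) (u, y)
        (0, EuclideanSpace.single i 1) := by
  rw [← partialDeriv_right ((isLocalNavigation (D := D) he).differentiableAt_momentum hu hy _)]
  exact partialDeriv_congr (Filter.eventually_of_mem (isOpen_compl_singleton.mem_nhds hy)
    fun y' hy' => partialDeriv_energy_right he hu hy' j) i

theorem partialDeriv_partialDeriv_energy (he : e ∈ IsManifold.maximalAtlas (𝓡 n) ∞ M)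
    (hu : u ∈ e.target) (hy : y ≠ 0) (i l : Fin n) :
    partialDeriv i (fun u' => partialDeriv l (fun y' => energy (randers D) e u' y') y) u =
      fderiv ℝ (momentum (localMetric D e) (localWind D e) (EuclideanSpace.single l 1)) (u, y)
        (EuclideanSpace.single i 1, 0) := by
  rw [← partialDeriv_left ((isLocalNavigation (D := D) he).differentiableAt_momentum hu hy _)]
  exact partialDeriv_congr (Filter.eventually_of_mem (e.open_target.mem_nhds hu)
    fun u' hu' => partialDeriv_energy_right he hu' hy l) i

/-- Multiplying by the invertible fundamental tensor removes its inverse: `G` is the geodesic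
coefficient exactly when the Euler-Lagrange equations hold along `(y, -2G)`. -/
theorem geodesicSprayCoeff_eq_iff (he : e ∈ IsManifold.maximalAtlas (𝓡 n) ∞ M)
    (hu : u ∈ e.target) (hy : y ≠ 0) (G : EuclideanSpace ℝ (Fin n)) :
    (⇑G = geodesicSprayCoeff (randers D) e u y) ↔
      ∀ l, fderiv ℝ (momentum (localMetric D e) (localWind D e) (EuclideanSpace.single l 1)) (u, y)
          (y, -((2 : ℝ) • G))
        - fderiv ℝ (energyField (localMetric D e) (localWind D e)) (u, y)
          (EuclideanSpace.single l 1, 0) = 0 := by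
  have H := isLocalNavigation (D := D) he
  set P := fun c => fderiv ℝ (momentum (localMetric D e) (localWind D e) c) (u, y) with hP
  set g := fundamentalTensor (randers D) e u y with hg
  have hsum : ∀ c v : EuclideanSpace ℝ (Fin n),
      P c (0, v) = ∑ i, v i * P c (0, EuclideanSpace.single i 1) := fun c v =>
    map_eq_sum ((P c).comp (ContinuousLinearMap.inr ℝ _ _)).toLinearMap v
  have hsum' : ∀ c v : EuclideanSpace ℝ (Fin n),
      P c (v, 0) = ∑ i, v i * P c (EuclideanSpace.single i 1, 0) := fun c v =>
    map_eq_sum ((P c).comp (ContinuousLinearMap.inl ℝ _ _)).toLinearMap v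
  have hcomm : ∀ c v, P c (0, v) = P v (0, c) := H.fderiv_momentum_vertical_comm hu hy
  have hgij : ∀ i j, g i j = P (EuclideanSpace.single j 1) (0, EuclideanSpace.single i 1) :=
    fundamentalTensor_eq he hu hy
  have hunit : IsUnit g.det := isUnit_of_pos fun v hv => by
    have h := H.fderiv_momentum_self_pos hu hy hv
    refine h.trans_eq ((hsum v v).trans (Finset.sum_congr rfl fun i _ => ?_))
    rw [hcomm, hsum, Finset.mul_sum]
    refine Finset.sum_congr rfl fun j _ => ?_
    rw [hgij, hcomm, mul_assoc]
  set r : Fin n → ℝ := fun l => P (EuclideanSpace.single l 1) (y, 0)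
    - fderiv ℝ (energyField (localMetric D e) (localWind D e)) (u, y)
      (EuclideanSpace.single l 1, 0) with hr
  have h1 : geodesicSprayCoeff (randers D) e u y = (1 / 2 : ℝ) • g⁻¹.mulVec r := by
    ext k
    simp only [geodesicSprayCoeff, partialDeriv_partialDeriv_energy he hu hy,
      partialDeriv_energy_left he hu hy, Pi.smul_apply, smul_eq_mul, Matrix.mulVec, dotProduct,
      hr, ← hg]
    refine congrArg _ (Finset.sum_congr rfl fun l _ => ?_)
    rw [hsum' _ y]
    simp only [mul_comm (y _), hP]
  have h2 : (⇑G = (1 / 2 : ℝ) • g⁻¹.mulVec r) ↔ g.mulVec ⇑G = (1 / 2 : ℝ) • r := by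
    constructor
    · intro h
      rw [h, Matrix.mulVec_smul, Matrix.mulVec_mulVec, Matrix.mul_nonsing_inv _ hunit,
        Matrix.one_mulVec]
    · intro h
      rw [← Matrix.mulVec_smul, ← h, Matrix.mulVec_mulVec, Matrix.nonsing_inv_mul _ hunit,
        Matrix.one_mulVec]
  rw [h1, h2, funext_iff]
  refine forall_congr' fun l => ?_
  have h3 : g.mulVec ⇑G l = P (EuclideanSpace.single l 1) (0, G) := by
    rw [hsum, Matrix.mulVec, dotProduct]
    exact Finset.sum_congr rfl fun k _ => by rw [hgij, hcomm, mul_comm]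
  have h4 : P (EuclideanSpace.single l 1) (y, -((2 : ℝ) • G)) =
      P (EuclideanSpace.single l 1) (y, 0) - 2 * P (EuclideanSpace.single l 1) (0, G) := by
    rw [← smul_eq_mul, ← map_smul, ← map_sub]
    simp
  rw [h3]
  change _ = (1 / 2 : ℝ) * (P (EuclideanSpace.single l 1) (y, 0) - _) ↔
    P (EuclideanSpace.single l 1) (y, -((2 : ℝ) • G)) - _ = 0
  rw [h4]
  constructor <;> intro h <;> linarith

theorem naturalSprayCoeff_eq_geodesicSprayCoeff_iff
    (he : e ∈ IsManifold.maximalAtlas (𝓡 n) ∞ M) (hu : u ∈ e.target) (hy : y ≠ 0) :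
    naturalSprayCoeff D e u y = geodesicSprayCoeff (randers D) e u y ↔
      ∀ c, normField (localMetric D e) (localWind D e) (u, y) *
          localMetric D e u (covDeriv D e u c) (unwound (localMetric D e u) (localWind D e u) y) =
        randersCovector (localMetric D e u) (localWind D e u) y c *
          localMetric D e u (covDeriv D e u y)
            (unwound (localMetric D e u) (localWind D e u) y) := by
  have H := isLocalNavigation (D := D) he
  have hμ := randersFactor_pos (H.symm u hu) (H.pos u hu) (H.wind_lt_one u hu) hy
  have hF : 0 < normField (localMetric D e) (localWind D e) (u, y) :=
    randersNorm_pos (H.pos u hu) (H.wind_lt_one u hu) hy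
  rw [show naturalSprayCoeff D e u y = _ from funext (naturalSprayCoeff_eq he hu y),
    geodesicSprayCoeff_eq_iff he hu hy]
  have h2 : ∀ z : EuclideanSpace ℝ (Fin n), (2 : ℝ) • (1 / 2 : ℝ) • z = z := fun z => by
    rw [smul_smul]; norm_num
  simp only [h2, covDeriv_apply, H.eulerLagrange_natural hu hy _ (christoffelMap_spec he hu),
    mul_eq_zero, (div_pos hF hμ).ne', false_or, sub_eq_zero]
  refine ⟨fun h => ?_, fun h l => h _⟩
  simp only [← covDeriv_apply] at h ⊢
  -- Both sides are linear in `c`, which passes from coordinate directions to all directions.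
  refine eq_of_single ⟨fun a b => ?_, fun r a => ?_⟩ ⟨fun a b => ?_, fun r a => ?_⟩ h
  · simp only [map_add, add_apply, mul_add]
  · simp only [map_smul, smul_apply, smul_eq_mul]
    ring
  · simp only [randersCovector, map_add, add_apply]
    ring
  · simp only [randersCovector, map_smul, smul_apply, smul_eq_mul]
    ring

theorem forall_naturalSprayCoeff_eq_iff (he : e ∈ IsManifold.maximalAtlas (𝓡 n) ∞ M)
    (hu : u ∈ e.target) :
    (∀ y, y ≠ 0 → naturalSprayCoeff D e u y = geodesicSprayCoeff (randers D) e u y) ↔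
      ∃ r : ℝ, ∀ c, covDeriv D e u c = r • c := by
  have H := isLocalNavigation (D := D) he
  have hs := H.symm u hu
  have hp := H.pos u hu
  have hl := H.wind_lt_one u hu
  constructor
  · intro h
    refine exists_eq_smul_of_preserves_orthogonal hp fun v c hv hc => ?_
    have hvv := hp v hv
    -- Normalise `v` and use `y = v/‖v‖ + W`, whose unwound vector is `v/‖v‖`.
    have hu1 : localMetric D e u ((√(localMetric D e u v v))⁻¹ • v)
        ((√(localMetric D e u v v))⁻¹ • v) = 1 := by
      have h1 := Real.mul_self_sqrt hvv.le
      have h2 := (Real.sqrt_pos.2 hvv).ne'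
      simp only [map_smul, smul_apply, smul_eq_mul]
      field_simp
      linarith
    obtain ⟨h1, h2⟩ := randersNorm_add_unit hs hp hl hu1
    have h3 := (naturalSprayCoeff_eq_geodesicSprayCoeff_iff he hu h2).1 (h _ h2) c
    rw [randersCovector, unwound_add_unit hs hp hl hu1, map_smul _ _ v, map_smul _ _ v, hc,
      smul_zero, zero_div, zero_mul, normField, h1, one_mul, smul_eq_mul] at h3
    exact (mul_eq_zero.1 h3).resolve_left (inv_ne_zero (Real.sqrt_pos.2 hvv).ne')
  · rintro ⟨r, hr⟩ y hy
    refine (naturalSprayCoeff_eq_geodesicSprayCoeff_iff he hu hy).2 fun c => ?_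
    have hμ := (randersFactor_pos hs hp hl hy).ne'
    rw [hr, hr, map_smul, map_smul, smul_apply, smul_apply, factor_mul_norm hs hp hl hy,
      randersCovector, normField]
    simp only [smul_eq_mul]
    field_simp

end Coordinates

/-! ### Gluing the pointwise homothety factors into a smooth function. -/

section Concircular

variable {n : ℕ} {M : Type*} [TopologicalSpace M] [ChartedSpace (EuclideanSpace ℝ (Fin n)) M]
  [IsManifold (𝓡 n) ∞ M] {D : NavigationData n M}
  {e e' : OpenPartialHomeomorph M (EuclideanSpace ℝ (Fin n))} {u : EuclideanSpace ℝ (Fin n)}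
  {p : M}

theorem covDerivWind_eq (he : e ∈ IsManifold.maximalAtlas (𝓡 n) ∞ M) (hp : p ∈ e.source)
    (X : TangentSpace (𝓡 n) p) :
    covDerivWind D e p X = covDeriv D e (e p) (components e p X) := by
  have hu := e.map_source hp
  ext k
  have h : ∀ y : EuclideanSpace ℝ (Fin n), (fderiv ℝ (localWind D e) (e p)) y k
      = ∑ i, y i * (fderiv ℝ (localWind D e) (e p) (EuclideanSpace.single i 1)) k := fun y =>
    map_eq_sum ((EuclideanSpace.proj (𝕜 := ℝ) k).comp
      (fderiv ℝ (localWind D e) (e p))).toLinearMap y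
  rw [covDeriv_apply, PiLp.add_apply, h]
  simp only [covDerivWind, christoffelMap_apply,
    partialDeriv_windCoeff he hu, windCoeff_eq, ← Finset.sum_add_distrib, mul_add, Finset.mul_sum]
  refine Finset.sum_congr rfl fun i _ => congrArg _ (Finset.sum_congr rfl fun j _ => ?_)
  ring

theorem contDiffOn_partialDeriv {f : EuclideanSpace ℝ (Fin n) → ℝ}
    {U : Set (EuclideanSpace ℝ (Fin n))} (hf : ContDiffOn ℝ ∞ f U) (hU : IsOpen U) (i : Fin n) :
    ContDiffOn ℝ ∞ (partialDeriv i f) U :=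
  (hf.fderiv_of_isOpen hU (by simp)).clm_apply contDiffOn_const

theorem contDiffOn_det {A : EuclideanSpace ℝ (Fin n) → Matrix (Fin n) (Fin n) ℝ}
    {U : Set (EuclideanSpace ℝ (Fin n))} (hA : ∀ i j, ContDiffOn ℝ ∞ (fun u => A u i j) U) :
    ContDiffOn ℝ ∞ (fun u => (A u).det) U := by
  simp only [Matrix.det_apply']
  exact ContDiffOn.sum fun σ _ => contDiffOn_const.mul (contDiffOn_prod fun i _ => hA _ _)

/-- Cramer's rule: adjugate entries are determinants of matrices with one row replaced by a
constant. -/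
theorem contDiffOn_inv_matrix {A : EuclideanSpace ℝ (Fin n) → Matrix (Fin n) (Fin n) ℝ}
    {U : Set (EuclideanSpace ℝ (Fin n))} (hA : ∀ i j, ContDiffOn ℝ ∞ (fun u => A u i j) U)
    (hU : ∀ u ∈ U, IsUnit (A u).det) (k l : Fin n) :
    ContDiffOn ℝ ∞ (fun u => (A u)⁻¹ k l) U := by
  simp only [Matrix.inv_def, Ring.inverse_eq_inv', Matrix.smul_apply, smul_eq_mul,
    Matrix.adjugate_apply]
  refine ((contDiffOn_det hA).inv fun u hu => (hU u hu).ne_zero).mul (contDiffOn_det fun i j => ?_)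
  by_cases h : i = l
  · subst h
    simpa only [Matrix.updateRow_self] using contDiffOn_const
  · simpa only [Matrix.updateRow_ne h] using hA i j

theorem contDiffOn_metricCoeff (he : e ∈ IsManifold.maximalAtlas (𝓡 n) ∞ M) (i j : Fin n) :
    ContDiffOn ℝ ∞ (fun u => metricCoeff D e u i j) e.target :=
  contDiffOn_localMetric_apply he _ _

theorem contDiffOn_christoffel (he : e ∈ IsManifold.maximalAtlas (𝓡 n) ∞ M) (k i j : Fin n) :
    ContDiffOn ℝ ∞ (christoffel D e k i j) e.target := by
  unfold christoffel
  have h := fun i j l => contDiffOn_partialDeriv (contDiffOn_metricCoeff (D := D) he i j)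
    e.open_target l
  exact contDiffOn_const.mul (ContDiffOn.sum fun l _ =>
    (contDiffOn_inv_matrix (contDiffOn_metricCoeff he) (fun u => isUnit_metricCoeff he) k l).mul
      (((h j l i).add (h i l j)).sub (h i j l)))

variable (D e u) in
/-- The mean of the diagonal of the covariant differential of the wind. -/
def meanDivergence : ℝ := (∑ k, covDeriv D e u (EuclideanSpace.single k 1) k) / n

theorem contDiffOn_meanDivergence (he : e ∈ IsManifold.maximalAtlas (𝓡 n) ∞ M) :
    ContDiffOn ℝ ∞ (meanDivergence D e) e.target := by
  unfold meanDivergence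
  refine ContDiffOn.div_const (ContDiffOn.sum fun k _ => ?_) _
  have hw := contDiffOn_localWind (D := D) he
  have hw' : ∀ j, ContDiffOn ℝ ∞ (fun u => localWind D e u j) e.target := fun j =>
    (EuclideanSpace.proj (𝕜 := ℝ) j).contDiff.comp_contDiffOn hw
  have h1 : ContDiffOn ℝ ∞
      (fun u => fderiv ℝ (localWind D e) u (EuclideanSpace.single k 1)) e.target :=
    (hw.fderiv_of_isOpen e.open_target (by simp)).clm_apply contDiffOn_const
  have h2 : ContDiffOn ℝ ∞
      (fun u => fderiv ℝ (localWind D e) u (EuclideanSpace.single k 1) k) e.target :=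
    (EuclideanSpace.proj (𝕜 := ℝ) k).contDiff.comp_contDiffOn h1
  have h3 : ContDiffOn ℝ ∞ (fun u => christoffelMap D e u (EuclideanSpace.single k 1)
      (localWind D e u) k) e.target := by
    simp only [christoffelMap_apply]
    exact ContDiffOn.sum fun i _ => ContDiffOn.sum fun j _ =>
      ((contDiffOn_christoffel he k i j).mul contDiffOn_const).mul (hw' j)
  exact h2.add h3

theorem meanDivergence_eq {r : ℝ} (hn : n ≠ 0) (h : ∀ c, covDeriv D e u c = r • c) :
    meanDivergence D e u = r := by
  have : (n : ℝ) ≠ 0 := Nat.cast_ne_zero.2 hn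
  simp [meanDivergence, h]
  field_simp

theorem localWind_apply (hp : p ∈ e.source) :
    localWind D e (e p) = components e p (D.wind p) :=
  congrArg (fun q => components e q (D.wind q)) (e.left_inv hp)

variable (D) in
/-- The squared length of the wind. -/
def windSq (p : M) : ℝ := D.metric.inner p (D.wind p) (D.wind p)

theorem localMetric_localWind (he : e ∈ IsManifold.maximalAtlas (𝓡 n) ∞ M) (hu : u ∈ e.target) :
    localMetric D e u (localWind D e u) (localWind D e u) = windSq D (e.symm u) := by
  have h : symmDeriv e u (localWind D e u) = D.wind (e.symm u) := symmDeriv_components he hu _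
  rw [localMetric_apply, h]
  rfl

/-- The intrinsic derivative of `‖W‖²` in the direction `W`, for a concircular wind. -/
theorem mfderiv_windSq (he : e ∈ IsManifold.maximalAtlas (𝓡 n) ∞ M) (hp : p ∈ e.source) {r : ℝ}
    (h : ∀ c, covDeriv D e (e p) c = r • c) :
    mfderiv (𝓡 n) 𝓘(ℝ) (windSq D) p (D.wind p) = 2 * r * windSq D p := by
  have H := isLocalNavigation (D := D) he
  have hu := e.map_source hp
  set q := fun u => localMetric D e u (localWind D e u) (localWind D e u) with hq
  have hqd : DifferentiableAt ℝ q (e p) :=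
    ((H.differentiableAt_metric hu).clm_apply (H.differentiableAt_wind hu)).clm_apply
      (H.differentiableAt_wind hu)
  have h1 : windSq D =ᶠ[nhds p] q ∘ e :=
    Filter.eventually_of_mem (e.open_source.mem_nhds hp) fun x hx => by
      simp only [hq, Function.comp]
      rw [localMetric_localWind he (e.map_source hx), e.left_inv hx]
  have h2 := (mdifferentiable_of_mem_maximalAtlas he).mdifferentiableAt hp
  have h3 := (hqd.hasFDerivAt.hasMFDerivAt.comp p h2.hasMFDerivAt).congr_of_eventuallyEq h1
  rw [h3.mfderiv]
  have h4 : fderiv ℝ q (e p) (localWind D e (e p)) = 2 * r * windSq D p := by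
    rw [H.fderiv_windSq hu _ (christoffelMap_spec he hu), ← covDeriv_apply, h, map_smul,
      smul_apply, localMetric_localWind he hu, e.left_inv hp, smul_eq_mul, mul_assoc]
  rw [localWind_apply hp] at h4
  exact h4

/-- Vanishing near `p`, and not only at `p`, also kills the derivative of the wind. -/
theorem meanDivergence_eq_zero (he : e ∈ IsManifold.maximalAtlas (𝓡 n) ∞ M) (hp : p ∈ e.source)
    (h : ∀ᶠ q in nhds p, windSq D q = 0) : meanDivergence D e (e p) = 0 := by
  have hu := e.map_source hp
  have h0 : localWind D e =ᶠ[nhds (e p)] fun _ => 0 := by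
    have h1 : ∀ᶠ u in nhds (e p), windSq D (e.symm u) = 0 :=
      (e.tendsto_symm hp).eventually h
    filter_upwards [h1, e.open_target.mem_nhds hu] with u h2 h3
    by_contra hne
    have h4 := localMetric_pos (D := D) he h3 hne
    rw [localMetric_localWind he h3, h2] at h4
    exact lt_irrefl _ h4
  have h5 : ∀ c, covDeriv D e (e p) c = 0 := fun c => by
    rw [covDeriv_apply, h0.fderiv_eq, h0.eq_of_nhds, map_zero]
    simp
  simp [meanDivergence, h5]

/-- If two charts disagree at `p`, by continuity they disagree near `p`. There `d‖W‖²(W) = 2 r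
‖W‖²`, whose left side ignores the chart, forces `W = 0`, so both values at `p` are zero after all.
-/
theorem meanDivergence_chart_indep
    (h : ∀ e ∈ IsManifold.maximalAtlas (𝓡 n) ∞ M, ∀ u ∈ e.target,
      ∃ r : ℝ, ∀ c, covDeriv D e u c = r • c) (hn : n ≠ 0)
    (he : e ∈ IsManifold.maximalAtlas (𝓡 n) ∞ M) (he' : e' ∈ IsManifold.maximalAtlas (𝓡 n) ∞ M)
    (hp : p ∈ e.source) (hp' : p ∈ e'.source) :
    meanDivergence D e (e p) = meanDivergence D e' (e' p) := by
  have key : ∀ q ∈ e.source, q ∈ e'.source →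
      meanDivergence D e (e q) ≠ meanDivergence D e' (e' q) → windSq D q = 0 := by
    intro q hq hq' hne
    obtain ⟨r, hr⟩ := h e he _ (e.map_source hq)
    obtain ⟨r', hr'⟩ := h e' he' _ (e'.map_source hq')
    rw [meanDivergence_eq hn hr, meanDivergence_eq hn hr'] at hne
    have h1 := (mfderiv_windSq he hq hr).symm.trans (mfderiv_windSq he' hq' hr')
    by_contra h0
    exact hne (by linarith [mul_right_cancel₀ h0 h1])
  have hc : ∀ e ∈ IsManifold.maximalAtlas (𝓡 n) ∞ M, p ∈ e.source →
      ContinuousAt (fun q => meanDivergence D e (e q)) p := fun e he hp =>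
    ContinuousAt.comp (g := meanDivergence D e)
      ((contDiffOn_meanDivergence he).continuousOn.continuousAt
      (e.open_target.mem_nhds (e.map_source hp))) (e.continuousAt hp)
  by_contra hne
  have h1 : ∀ᶠ q in nhds p, windSq D q = 0 := by
    filter_upwards [((hc e he hp).sub (hc e' he' hp')).eventually_ne (sub_ne_zero.2 hne),
      e.open_source.mem_nhds hp, e'.open_source.mem_nhds hp'] with q h1 h2 h3
    exact key q h2 h3 (sub_ne_zero.1 h1)
  exact hne ((meanDivergence_eq_zero he hp h1).trans (meanDivergence_eq_zero he' hp' h1).symm)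

/-- Neither smoothness nor globality of `φ` is an extra condition: both come for free from pointwise
homotheties in all charts. -/
theorem isConcircular_iff : IsConcircular D ↔
    ∀ e ∈ IsManifold.maximalAtlas (𝓡 n) ∞ M, ∀ u ∈ e.target,
      ∃ r : ℝ, ∀ c, covDeriv D e u c = r • c := by
  have hsmul : ∀ (e : OpenPartialHomeomorph M (EuclideanSpace ℝ (Fin n))) (p : M) (r : ℝ)
      (X : TangentSpace (𝓡 n) p), components e p (r • X) = r • components e p X :=
    fun e p r X => map_smul (mfderiv (𝓡 n) (𝓡 n) e p) r X
  constructor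
  · rintro ⟨φ, -, h⟩ e he u hu
    refine ⟨φ (e.symm u), fun c => ?_⟩
    have h1 := h e he (e.symm u) (e.map_target hu) (symmDeriv e u c)
    have h2 := (covDerivWind_eq (D := D) he (e.map_target hu) (symmDeriv e u c)).symm.trans
      (h1.trans (hsmul e (e.symm u) (φ (e.symm u)) (symmDeriv e u c)))
    rwa [components_symmDeriv he hu, e.right_inv hu] at h2
  · intro h
    -- In dimension zero the identity is trivial; otherwise dividing the trace by `n` recovers the
    -- factor.
    rcases eq_or_ne n 0 with rfl | hn
    · exact ⟨fun _ => 0, contMDiff_const, fun e he p hp X => Subsingleton.elim _ _⟩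
    set φ : M → ℝ := fun p => meanDivergence D (chartAt (EuclideanSpace ℝ (Fin n)) p)
      (chartAt (EuclideanSpace ℝ (Fin n)) p p) with hφ
    have hφe : ∀ e ∈ IsManifold.maximalAtlas (𝓡 n) ∞ M, ∀ p ∈ e.source,
        φ p = meanDivergence D e (e p) := fun e he p hp =>
      meanDivergence_chart_indep h hn (IsManifold.chart_mem_maximalAtlas p) he
        (mem_chart_source _ p) hp
    refine ⟨φ, fun p => ?_, fun e he p hp X => ?_⟩
    · have he := IsManifold.chart_mem_maximalAtlas (I := 𝓡 n) (n := ∞) p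
      have hp := mem_chart_source (EuclideanSpace ℝ (Fin n)) p
      set e := chartAt (EuclideanSpace ℝ (Fin n)) p
      have h1 : ContMDiffAt (𝓡 n) 𝓘(ℝ, ℝ) ∞ (meanDivergence D e) (e p) :=
        ((contDiffOn_meanDivergence he).contDiffAt
          (e.open_target.mem_nhds (e.map_source hp))).contMDiffAt
      exact (h1.comp p (contMDiffAt_of_mem_maximalAtlas he hp)).congr_of_eventuallyEq
        (Filter.eventually_of_mem (e.open_source.mem_nhds hp) fun q hq => hφe e he q hq)
    · obtain ⟨r, hr⟩ := h e he _ (e.map_source hp)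
      rw [covDerivWind_eq he hp, hr, hsmul, hφe e he p hp, meanDivergence_eq hn hr]

end Concircular
end Navigation

end

theorem mainTheorem3 {n : ℕ} {M : Type*} [TopologicalSpace M]
    [ChartedSpace (EuclideanSpace ℝ (Fin n)) M] [IsManifold (𝓡 n) ∞ M]
    (D : Navigation.NavigationData n M) :
    (∀ e ∈ IsManifold.maximalAtlas (𝓡 n) ∞ M,
      ∀ v : TangentBundle (𝓡 n) M, v.proj ∈ e.source → v.2 ≠ 0 →
        Navigation.naturalSpray D e v = Navigation.geodesicSpray (Navigation.randers D) e v) ↔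
      Navigation.IsConcircular D := by
  rw [Navigation.isConcircular_iff]
  refine forall₂_congr fun e he => ?_
  have h0 : (∀ u ∈ e.target, ∃ r : ℝ, ∀ c, Navigation.covDeriv D e u c = r • c) ↔
      ∀ u ∈ e.target, ∀ y, y ≠ 0 → Navigation.naturalSprayCoeff D e u y =
        Navigation.geodesicSprayCoeff (Navigation.randers D) e u y :=
    forall₂_congr fun u hu => (Navigation.forall_naturalSprayCoeff_eq_iff he hu).symm
  rw [h0]
  constructor
  · intro h u hu y hy
    -- Test the sprays at the tangent vector with coordinates `(u, y)`, which is nonzero because `y`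
    -- is.
    have h1 := (Navigation.sprayOfCoeff_eq_iff he (v := Navigation.tangentParam e (u, y))
      (e.map_target hu)).1 (h _ (e.map_target hu) fun h2 => hy ?_)
    · have h3 := Navigation.tangentCoord_tangentParam he (z := (u, y)) hu
      simp only [Navigation.tangentCoord, Prod.mk.injEq] at h3
      rwa [h3.1, h3.2] at h1
    · have h3 := Navigation.components_symmDeriv he hu y
      have h4 : Navigation.symmDeriv e u y = 0 := h2
      rw [h4] at h3
      exact h3.symm.trans (map_zero (mfderiv (𝓡 n) (𝓡 n) e (e.symm u)))
  · intro h v hv hv0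
    refine (Navigation.sprayOfCoeff_eq_iff he hv).2 (h _ (e.map_source hv) _ fun h1 => hv0 ?_)
    exact (Navigation.mdifferentiable_of_mem_maximalAtlas he).mfderiv_injective hv
      (h1.trans (map_zero (mfderiv (𝓡 n) (𝓡 n) e v.proj)).symm)
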